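/- Let $N\ge 1$ be an integer, $1<p<\infty$, $\Omega\subset\mathbb R^N$ an open set, and let $r_\Omega=\sup_{x\in\Omega} d(x,\mathbb R^N\setminus\Omega)\in[0,\infty]$ be its inner radius. Let $w:\Omega\to\mathbb R$ be a weight. A real number $\lambda$ is an eigenvalue of $-\Delta_p u=\lambda w|u|^{p-2}u$ in $\Omega$ with zero Dirichlet boundary conditions if there is a function $u\in W_0^{1,p}(\Omega)$, $u\neq 0$, such that $$\int_\Omega |\nabla u|^{p-2}\nabla u\cdot\nabla\varphi\,dx=\lambda\int_\Omega w|u|^{p-2}u\,\varphi\,dx\qquad\text{for all }\varphi\in W_0^{1,p}(\Omega),$$ where $W_0^{1,p}(\Omega)$ is the closure of $C_c^\infty(\Omega)$ in $W^{1,p}(\Omega)$. Let $\lambda_1=\lambda_1(p,\Omega,w)\in[0,\infty]$ denote the first eigenvalue, that is, the infimum of the positive eigenvalues ($\infty$ if there are none). In the inequalities below $1/0=\infty$, $1/\infty=0$ and $0\cdot\infty=0$. (i) Let $p>N$. There is a constant $C>0$ depending only on $p$ and $N$ such that for every open $\Omega\subset\mathbb R^N$ and every $w\in L^1(\Omega)$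 with $w\ge 0$, $$\frac{C}{r_\Omega^{\,p-N}\,\|w\|_{L^1(\Omega)}}\le\lambda_1 .$$ (ii) Let $1<p<N$. (a) For every $c>0$ there is a constant $C>0$ depending only on $p$, $N$ and $c$ such that, for every open $\Omega\subset\mathbb R^N$ whose complement satisfies the capacity density condition with constant $c$, every real $s>N/p$ and every $w\in L^s(\Omega)$ (of any sign), $$\frac{C}{r_\Omega^{\,(sp-N)/s}\,\|w\|_{L^s(\Omega)}}\le\lambda_1 .$$ Here the capacity density condition with constant $c$ means that $$\operatorname{cap}_p\big(\overline{B}(x,r)\setminus\Omega,\,B(x,2r)\big)\ \ge\ c\,\operatorname{cap}_p\big(\overline{B}(x,r),\,B(x,2r)\big)\qquad\text{for all }x\in\mathbb R^N\setminus\Omega,\ r>0,$$ where $\operatorname{cap}_p(K,D)=\inf\{\int_D|\nabla\varphi|^p\,dx:\ \varphi\in C_c^\infty(D),\ \varphi\ge 1\text{ on }K\}$. (b) For every open $\Omega\subset\mathbb R^N$ of finite measure (in particular, for every bounded smooth domain) there is a constant $C>0$ depending only on $p$, $N$ and $\Omega$ such that the same inequality holds for every real $s>N/p$ and every $w\in L^s(\Omega)$.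 -/

import Mathlib

open MeasureTheory
open scoped ContDiff

/-- Test functions: real functions of class `C^∞` with compact support contained in `D`. -/
def IsTestFunction {N : ℕ} (D : Set (EuclideanSpace ℝ (Fin N)))
    (φ : EuclideanSpace ℝ (Fin N) → ℝ) : Prop :=
  ContDiff ℝ ∞ φ ∧ HasCompactSupport φ ∧ tsupport φ ⊆ D

/-- `G` is the distributional gradient of `u` in `Ω`:
`∫_Ω u ∂_v ψ = - ∫_Ω (G · v) ψ` for all test functions `ψ` and all directions `v`. -/
def HasWeakGradient {N : ℕ} (Ω : Set (EuclideanSpace ℝ (Fin N)))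
    (u : EuclideanSpace ℝ (Fin N) → ℝ)
    (G : EuclideanSpace ℝ (Fin N) → EuclideanSpace ℝ (Fin N)) : Prop :=
  ∀ ψ : EuclideanSpace ℝ (Fin N) → ℝ, IsTestFunction Ω ψ → ∀ v : EuclideanSpace ℝ (Fin N),
    ∫ x in Ω, u x * fderiv ℝ ψ x v = -∫ x in Ω, inner ℝ (G x) v * ψ x

/-- `u ∈ W^{1,p}(Ω)` with weak gradient `G`. -/
def MemW1p {N : ℕ} (p : ℝ) (Ω : Set (EuclideanSpace ℝ (Fin N)))
    (u : EuclideanSpace ℝ (Fin N) → ℝ)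
    (G : EuclideanSpace ℝ (Fin N) → EuclideanSpace ℝ (Fin N)) : Prop :=
  MemLp u (ENNReal.ofReal p) (volume.restrict Ω) ∧
  MemLp G (ENNReal.ofReal p) (volume.restrict Ω) ∧
  HasWeakGradient Ω u G

/-- `u ∈ W_0^{1,p}(Ω)` with weak gradient `G`: `u` lies in the closure of the test functions
in the norm of `W^{1,p}(Ω)`. -/
def MemW01p {N : ℕ} (p : ℝ) (Ω : Set (EuclideanSpace ℝ (Fin N)))
    (u : EuclideanSpace ℝ (Fin N) → ℝ)
    (G : EuclideanSpace ℝ (Fin N) → EuclideanSpace ℝ (Fin N)) : Prop :=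
  MemW1p p Ω u G ∧
  ∀ ε : ℝ, 0 < ε → ∃ φ : EuclideanSpace ℝ (Fin N) → ℝ, IsTestFunction Ω φ ∧
    eLpNorm (fun x => u x - φ x) (ENNReal.ofReal p) (volume.restrict Ω) ≤ ENNReal.ofReal ε ∧
    eLpNorm (fun x => G x - gradient φ x) (ENNReal.ofReal p) (volume.restrict Ω)
      ≤ ENNReal.ofReal ε

/-- `l` is an eigenvalue of `-Δ_p u = l w |u|^{p-2} u` in `Ω` with zero Dirichlet boundary
values: there is a nontrivial weak solution `u ∈ W_0^{1,p}(Ω)`, tested against all of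
`W_0^{1,p}(Ω)`. -/
def IsDirichletEigenvalue {N : ℕ} (p : ℝ) (Ω : Set (EuclideanSpace ℝ (Fin N)))
    (w : EuclideanSpace ℝ (Fin N) → ℝ) (l : ℝ) : Prop :=
  ∃ (u : EuclideanSpace ℝ (Fin N) → ℝ)
    (G : EuclideanSpace ℝ (Fin N) → EuclideanSpace ℝ (Fin N)),
    MemW01p p Ω u G ∧ ¬ (u =ᵐ[volume.restrict Ω] 0) ∧
    ∀ (φ : EuclideanSpace ℝ (Fin N) → ℝ)
      (H : EuclideanSpace ℝ (Fin N) → EuclideanSpace ℝ (Fin N)), MemW01p p Ω φ H →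
      ∫ x in Ω, ‖G x‖ ^ (p - 2) * inner ℝ (G x) (H x) =
        l * ∫ x in Ω, w x * |u x| ^ (p - 2) * u x * φ x

/-- The first eigenvalue: the infimum of the positive eigenvalues (`∞` if there are none). -/
noncomputable def firstEigenvalue {N : ℕ} (p : ℝ) (Ω : Set (EuclideanSpace ℝ (Fin N)))
    (w : EuclideanSpace ℝ (Fin N) → ℝ) : ENNReal :=
  ⨅ (l : ℝ) (_ : 0 < l ∧ IsDirichletEigenvalue p Ω w l), ENNReal.ofReal l

/-- The inner radius: the supremum over `x ∈ Ω` of the distance from `x` to the complement. -/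
noncomputable def innerRadius {N : ℕ} (Ω : Set (EuclideanSpace ℝ (Fin N))) : ENNReal :=
  ⨆ x ∈ Ω, Metric.infEDist x Ωᶜ

/-- The variational `p`-capacity of `K` relative to `D`: the infimum of `∫ |∇φ|^p` over test
functions `φ` in `D` with `φ ≥ 1` on `K`. It is used for compact `K` and open `D`. -/
noncomputable def pCapacity {N : ℕ} (p : ℝ) (K D : Set (EuclideanSpace ℝ (Fin N))) : ENNReal :=
  ⨅ (φ : EuclideanSpace ℝ (Fin N) → ℝ) (_ : IsTestFunction D φ ∧ ∀ x ∈ K, 1 ≤ φ x),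
    ∫⁻ x, ENNReal.ofReal (‖gradient φ x‖ ^ p)

/-- The closed set `F` is uniformly `p`-fat (it satisfies the capacity density condition)
with constant `c`. -/
def IsUniformlyFat {N : ℕ} (p c : ℝ) (F : Set (EuclideanSpace ℝ (Fin N))) : Prop :=
  ∀ x ∈ F, ∀ r : ℝ, 0 < r →
    ENNReal.ofReal c * pCapacity p (Metric.closedBall x r) (Metric.ball x (2 * r)) ≤
      pCapacity p (F ∩ Metric.closedBall x r) (Metric.ball x (2 * r))

/-! Everything reduces to a weighted Poincaré inequality `∫ |w| |φ|^p ≤ A ∫ |∇φ|^p` for test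
functions. It passes to `W_0^{1,p}` by Fatou. Testing the equation with the eigenfunction itself
gives `E = ∫ |∇u|^p = λ ∫ w |u|^p ≤ λ A E`, and dividing by `E` yields `1/A ≤ λ`
(`inv_le_firstEigenvalue`). This needs `0 < E < ∞`; positivity says that `W_0^{1,p}` contains no
nonzero function with zero gradient, on any open set.

For `p > N`, every point is within `r_Ω` of a zero of `φ`, so Morrey's inequality bounds `|φ|^p`
pointwise by a multiple of `r_Ω^(p-N) ∫ |∇φ|^p`; integrate against `|w|`.

For `p < N`, a three-factor Hölder inequality interpolates between Sobolev and an unweighted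
Poincaré inequality with constant of order `r_Ω^p` (`setLIntegral_weight_le`). If the complement is
fat, the latter is Maz'ya's: on a ball centred at a point of the complement, `η (1 - φ/φ(z))`
competes for the capacity of the zero set; averaging over `z` bounds `∫ |φ|^p` times the capacity by
the energy, and fatness with Sobolev bounds the capacity below by a power of the volume. Averaging
over all balls makes this global. If `Ω` has finite measure, Sobolev and Hölder suffice, since the
constant may depend on `Ω`. -/

section FiniteDimensional

/-! ### Poincaré and Morrey estimates on convex sets. -/

variable {E : Type*} [NormedAddCommGroup E] [NormedSpace ℝ E]

/-- The increment of a `C^1` function is controlled by its derivative along the segment. -/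
lemma enorm_sub_le_lintegral_fderiv {φ : E → ℝ} (hφ : ContDiff ℝ 1 φ) (x z : E) :
    ‖φ z - φ x‖ₑ ≤
      ‖z - x‖ₑ * ∫⁻ t in Set.Ioc (0 : ℝ) 1, ‖fderiv ℝ φ (x + t • (z - x))‖ₑ := by
  have hc : Continuous fun t : ℝ => fderiv ℝ φ (x + t • (z - x)) :=
    (hφ.continuous_fderiv one_ne_zero).comp (by fun_prop)
  have hd : ∀ t ∈ Set.uIcc (0 : ℝ) 1, HasDerivAt (fun t : ℝ => φ (x + t • (z - x)))
      (fderiv ℝ φ (x + t • (z - x)) (z - x)) t := by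
    intro t _
    have h1 : HasDerivAt (fun t : ℝ => x + t • (z - x)) (z - x) t := by
      simpa using ((hasDerivAt_id t).smul_const (z - x)).const_add x
    exact ((hφ.differentiable one_ne_zero _).hasFDerivAt).comp_hasDerivAt t h1
  have hc' : Continuous fun t : ℝ => fderiv ℝ φ (x + t • (z - x)) (z - x) :=
    hc.clm_apply continuous_const
  have h := intervalIntegral.integral_eq_sub_of_hasDerivAt hd (hc'.intervalIntegrable 0 1)
  simp only [one_smul, add_sub_cancel, zero_smul, add_zero] at h
  rw [← h, intervalIntegral.integral_of_le zero_le_one, ← lintegral_const_mul]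
  · refine (enorm_integral_le_lintegral_enorm _).trans (lintegral_mono fun t => ?_)
    rw [mul_comm]
    exact ContinuousLinearMap.le_opENorm _ _
  · exact hc.enorm.measurable

/-- Hölder's inequality against the constant function `1`. -/
lemma lintegral_le_rpow_mul_measure {α : Type*} [MeasurableSpace α] {μ : Measure α}
    {f : α → ENNReal} (hf : AEMeasurable f μ) {p : ℝ} (hp : 1 ≤ p) :
    ∫⁻ a, f a ∂μ ≤ (∫⁻ a, f a ^ p ∂μ) ^ (1 / p) * μ Set.univ ^ (1 - 1 / p) := by
  have hp0 : 0 < p := by linarith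
  have h := ENNReal.lintegral_mul_norm_pow_le (μ := μ) (hf.pow_const p)
    (aemeasurable_const (b := (1 : ENNReal))) (p := 1 / p) (q := 1 - 1 / p) (by positivity)
    (by rw [sub_nonneg, div_le_one hp0]; exact hp) (by ring)
  simpa [← ENNReal.rpow_mul, hp0.ne'] using h

variable [MeasurableSpace E] [BorelSpace E] [FiniteDimensional ℝ E]
  (μ : Measure E) [μ.IsAddHaarMeasure]

lemma lintegral_comp_add_smul {f : E → ENNReal} (hf : Measurable f) (a : E) {t : ℝ}
    (ht : 0 < t) :
    ∫⁻ z, f (a + t • z) ∂μ =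
      ENNReal.ofReal (t ^ Module.finrank ℝ E)⁻¹ * ∫⁻ z, f z ∂μ := by
  have h1 : ∫⁻ z, f (a + t • z) ∂μ = ∫⁻ y, f (a + y) ∂(Measure.map (fun z => t • z) μ) := by
    rw [lintegral_map (by fun_prop) (by fun_prop)]
  rw [h1, Measure.map_addHaar_smul μ ht.ne', lintegral_smul_measure,
    lintegral_add_left_eq_self f a, abs_of_pos (by positivity), smul_eq_mul]

/-- Contracting a convex set towards one of its points costs at most the Jacobian. -/
lemma setLIntegral_comp_segment_le {g : E → ENNReal} (hg : Measurable g) {B : Set E}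
    (hB : Convex ℝ B) (hBm : MeasurableSet B) {x : E} (hx : x ∈ B) {t : ℝ} (ht : 0 < t)
    (ht1 : t ≤ 1) :
    ∫⁻ z in B, g (x + t • (z - x)) ∂μ ≤
      ENNReal.ofReal (t ^ Module.finrank ℝ E)⁻¹ * ∫⁻ z in B, g z ∂μ := by
  rw [← lintegral_indicator hBm g,
    ← lintegral_comp_add_smul μ (hg.indicator hBm) (x - t • x) ht, ← lintegral_indicator hBm]
  refine lintegral_mono fun z => ?_
  by_cases hz : z ∈ B
  · have h : x + t • (z - x) = x - t • x + t • z := by rw [smul_sub]; abel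
    have hm : x - t • x + t • z ∈ B := h ▸ hB.add_smul_sub_mem hx hz ⟨ht.le, ht1⟩
    simp only [Set.indicator_of_mem hz, Set.indicator_of_mem hm, h, le_refl]
  · simp [Set.indicator_of_notMem hz]

/-- A Poincaré inequality on convex sets, in the form of a double integral. -/
lemma setLIntegral_setLIntegral_enorm_sub_le {φ : E → ℝ} (hφ : ContDiff ℝ 1 φ) {B : Set E}
    (hB : Convex ℝ B) (hBm : MeasurableSet B) {d p : ℝ} (hp : 1 ≤ p)
    (hd : ∀ x ∈ B, ∀ z ∈ B, dist z x ≤ d) :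
    ∫⁻ x in B, ∫⁻ z in B, ‖φ z - φ x‖ₑ ^ p ∂μ ∂μ ≤
      ENNReal.ofReal d ^ p * (2 ^ Module.finrank ℝ E * μ B *
        ∫⁻ z in B, ‖fderiv ℝ φ z‖ₑ ^ p ∂μ) := by
  have hp0 : 0 < p := by linarith
  have hcont : Continuous (fderiv ℝ φ) := hφ.continuous_fderiv one_ne_zero
  set g : E → ENNReal := fun z => ‖fderiv ℝ φ z‖ₑ ^ p with hgdef
  have hg : Measurable g := hcont.enorm.measurable.pow_const p
  have hpt : ∀ x ∈ B, ∀ z ∈ B, ‖φ z - φ x‖ₑ ^ p ≤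
      ENNReal.ofReal d ^ p * ∫⁻ t in Set.Ioc (0 : ℝ) 1, g (x + t • (z - x)) := by
    intro x hx z hz
    have hm : Measurable fun t : ℝ => ‖fderiv ℝ φ (x + t • (z - x))‖ₑ :=
      (hcont.comp (by fun_prop : Continuous fun t : ℝ => x + t • (z - x))).enorm.measurable
    have h1 := lintegral_le_rpow_mul_measure (μ := volume.restrict (Set.Ioc (0 : ℝ) 1))
      hm.aemeasurable hp
    simp only [Measure.restrict_apply MeasurableSet.univ, Set.univ_inter, Real.volume_Ioc,
      sub_zero, ENNReal.ofReal_one, ENNReal.one_rpow, mul_one] at h1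
    calc ‖φ z - φ x‖ₑ ^ p
        ≤ (ENNReal.ofReal d * (∫⁻ t in Set.Ioc (0 : ℝ) 1, g (x + t • (z - x))) ^ (1 / p)) ^ p := by
          gcongr
          refine (enorm_sub_le_lintegral_fderiv hφ x z).trans (mul_le_mul' ?_ h1)
          rw [← ofReal_norm, ← dist_eq_norm]
          exact ENNReal.ofReal_le_ofReal (hd x hx z hz)
      _ = _ := by
          rw [ENNReal.mul_rpow_of_nonneg _ _ hp0.le, ← ENNReal.rpow_mul,
            one_div_mul_cancel hp0.ne', ENNReal.rpow_one]
  set K : ENNReal := 2 ^ Module.finrank ℝ E * μ B * ∫⁻ z in B, g z ∂μ with hK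
  have hjac : ∀ t : ℝ, 1 / 2 ≤ t →
      ENNReal.ofReal (t ^ Module.finrank ℝ E)⁻¹ ≤ 2 ^ Module.finrank ℝ E := by
    intro t ht
    have h2 : (2 : ENNReal) ^ Module.finrank ℝ E = ENNReal.ofReal (2 ^ Module.finrank ℝ E) := by
      rw [ENNReal.ofReal_pow (by norm_num)]; simp
    rw [h2, ← inv_pow]
    refine ENNReal.ofReal_le_ofReal (pow_le_pow_left₀ (by positivity) ?_ _)
    rw [inv_le_comm₀ (by linarith) (by norm_num)]
    linarith
  have hside : ∀ t : ℝ, 1 / 2 ≤ t → t ≤ 1 → ∀ x ∈ B,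
      ∫⁻ z in B, g (x + t • (z - x)) ∂μ ≤ 2 ^ Module.finrank ℝ E * ∫⁻ z in B, g z ∂μ := by
    intro t ht ht1 x hx
    refine (setLIntegral_comp_segment_le μ hg hB hBm hx (by linarith) ht1).trans ?_
    gcongr
    exact hjac t ht
  have hconst : ∫⁻ _ in B, 2 ^ Module.finrank ℝ E * ∫⁻ z in B, g z ∂μ ∂μ = K := by
    rw [lintegral_const, Measure.restrict_apply MeasurableSet.univ, Set.univ_inter, hK]
    ring
  have hgm : ∀ t : ℝ, Measurable (Function.uncurry fun x z : E => g (x + t • (z - x))) := by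
    intro t
    exact hg.comp (by fun_prop : Measurable fun q : E × E => q.1 + t • (q.2 - q.1))
  have ht : ∀ t ∈ Set.Ioc (0 : ℝ) 1,
      ∫⁻ x in B, ∫⁻ z in B, g (x + t • (z - x)) ∂μ ∂μ ≤ K := by
    intro t ht
    rw [← hconst]
    -- The Jacobian `t^(-n)` blows up at `t = 0`. The segment is symmetric under exchanging `x` and
    -- `z` and replacing `t` by `1 - t`, so it suffices to contract by factors at least `1/2`,
    -- whence the constant `2^n`.
    rcases le_total (1 / 2) t with h | h
    · exact setLIntegral_mono' hBm fun x hx => hside t h ht.2 x hx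
    · rw [lintegral_lintegral_swap (hgm t).aemeasurable]
      refine setLIntegral_mono' hBm fun z hz => ?_
      refine le_trans (le_of_eq ?_) (hside (1 - t) (by linarith) (by linarith [ht.1]) z hz)
      refine lintegral_congr fun x => ?_
      congr 1
      module
  calc ∫⁻ x in B, ∫⁻ z in B, ‖φ z - φ x‖ₑ ^ p ∂μ ∂μ
      ≤ ∫⁻ x in B, ∫⁻ z in B, ENNReal.ofReal d ^ p *
          (∫⁻ t in Set.Ioc (0 : ℝ) 1, g (x + t • (z - x))) ∂μ ∂μ :=
        setLIntegral_mono' hBm fun x hx => setLIntegral_mono' hBm fun z hz => hpt x hx z hz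
    _ = ENNReal.ofReal d ^ p * ∫⁻ t in Set.Ioc (0 : ℝ) 1, ∫⁻ x in B, ∫⁻ z in B,
          g (x + t • (z - x)) ∂μ ∂μ := by
        have e1 : ∀ x, ∫⁻ z in B, ENNReal.ofReal d ^ p *
            (∫⁻ t in Set.Ioc (0 : ℝ) 1, g (x + t • (z - x))) ∂μ = ENNReal.ofReal d ^ p *
            ∫⁻ t in Set.Ioc (0 : ℝ) 1, ∫⁻ z in B, g (x + t • (z - x)) ∂μ := by
          intro x
          have hmx : Measurable fun q : E × ℝ => g (x + q.2 • (q.1 - x)) := hg.comp (by fun_prop)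
          have hmx' : Measurable fun z : E => ∫⁻ t in Set.Ioc (0 : ℝ) 1, g (x + t • (z - x)) :=
            hmx.lintegral_prod_right'
          rw [lintegral_const_mul _ hmx', lintegral_lintegral_swap hmx.aemeasurable]
        simp_rw [e1]
        have hm3 : Measurable fun q : (E × ℝ) × E => g (q.1.1 + q.1.2 • (q.2 - q.1.1)) :=
          hg.comp (by fun_prop)
        have hm2 : Measurable fun q : E × ℝ => ∫⁻ z in B, g (q.1 + q.2 • (z - q.1)) ∂μ :=
          hm3.lintegral_prod_right'
        have hm1 : Measurable fun x : E => ∫⁻ t in Set.Ioc (0 : ℝ) 1,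
            ∫⁻ z in B, g (x + t • (z - x)) ∂μ := hm2.lintegral_prod_right'
        rw [lintegral_const_mul _ hm1, lintegral_lintegral_swap hm2.aemeasurable]
    _ ≤ ENNReal.ofReal d ^ p * ∫⁻ _ in Set.Ioc (0 : ℝ) 1, K := by
        exact mul_le_mul' le_rfl (setLIntegral_mono' measurableSet_Ioc ht)
    _ = ENNReal.ofReal d ^ p * K := by simp

/-- Morrey's estimate for the distance of a value of `φ` to the values on a convex set. -/
lemma setLIntegral_enorm_sub_le {φ : E → ℝ} (hφ : ContDiff ℝ 1 φ) {B : Set E}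
    (hB : Convex ℝ B) (hBm : MeasurableSet B) {d p : ℝ} (hp1 : 1 ≤ p)
    (hp : (Module.finrank ℝ E : ℝ) < p) {x : E} (hx : x ∈ B)
    (hd : ∀ z ∈ B, dist z x ≤ d) :
    ∫⁻ z in B, ‖φ z - φ x‖ₑ ∂μ ≤
      ENNReal.ofReal d * (ENNReal.ofReal (1 / (1 - Module.finrank ℝ E / p)) *
        ((∫⁻ z in B, ‖fderiv ℝ φ z‖ₑ ^ p ∂μ) ^ (1 / p) * μ B ^ (1 - 1 / p))) := by
  have hp0 : 0 < p := by linarith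
  set n := Module.finrank ℝ E with hn
  have hcont : Continuous (fderiv ℝ φ) := hφ.continuous_fderiv one_ne_zero
  have hm : Measurable fun q : E × ℝ => ‖fderiv ℝ φ (x + q.2 • (q.1 - x))‖ₑ :=
    (hcont.comp (by fun_prop : Continuous fun q : E × ℝ => x + q.2 • (q.1 - x))).enorm.measurable
  set K : ENNReal := (∫⁻ z in B, ‖fderiv ℝ φ z‖ₑ ^ p ∂μ) ^ (1 / p) * μ B ^ (1 - 1 / p) with hK
  have ht : ∀ t ∈ Set.Ioc (0 : ℝ) 1, ∫⁻ z in B, ‖fderiv ℝ φ (x + t • (z - x))‖ₑ ∂μ ≤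
      ENNReal.ofReal (t ^ (-(n / p) : ℝ)) * K := by
    intro t ht
    have h1 := lintegral_le_rpow_mul_measure (μ := μ.restrict B)
      (hm.comp (by fun_prop : Measurable fun z : E => (z, t))).aemeasurable hp1
    refine h1.trans ?_
    simp only [Function.comp_apply, Measure.restrict_apply MeasurableSet.univ, Set.univ_inter]
    rw [hK, ← mul_assoc]
    gcongr
    have h2 := setLIntegral_comp_segment_le μ (hcont.enorm.measurable.pow_const p) hB hBm hx
      ht.1 ht.2
    refine (ENNReal.rpow_le_rpow h2 (by positivity)).trans (le_of_eq ?_)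
    rw [ENNReal.mul_rpow_of_nonneg _ _ (by positivity),
      ENNReal.ofReal_rpow_of_nonneg (by have := ht.1; positivity) (by positivity)]
    congr 2
    rw [← Real.rpow_natCast, ← Real.rpow_neg ht.1.le, ← Real.rpow_mul ht.1.le]
    congr 1
    ring
  -- Here `p > n` enters: after Hölder the Jacobian costs `t^(-n/p)`, which is integrable at `0`.
  have hnp : -1 < -(n / p : ℝ) := by rw [neg_lt_neg_iff, div_lt_one hp0]; exact hp
  have hint : ∫⁻ t in Set.Ioc (0 : ℝ) 1, ENNReal.ofReal (t ^ (-(n / p) : ℝ)) =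
      ENNReal.ofReal (1 / (1 - n / p)) := by
    rw [← ofReal_integral_eq_lintegral_ofReal, ← intervalIntegral.integral_of_le zero_le_one,
      integral_rpow (Or.inl hnp)]
    · rw [Real.one_rpow, Real.zero_rpow (by linarith)]
      congr 1
      ring
    · exact (intervalIntegral.intervalIntegrable_rpow' hnp).1
    · filter_upwards [ae_restrict_mem measurableSet_Ioc] with t ht
      exact Real.rpow_nonneg ht.1.le _
  calc ∫⁻ z in B, ‖φ z - φ x‖ₑ ∂μ
      ≤ ∫⁻ z in B, ENNReal.ofReal d *
          (∫⁻ t in Set.Ioc (0 : ℝ) 1, ‖fderiv ℝ φ (x + t • (z - x))‖ₑ) ∂μ := by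
        refine setLIntegral_mono' hBm fun z hz => ?_
        refine (enorm_sub_le_lintegral_fderiv hφ x z).trans ?_
        gcongr
        rw [← ofReal_norm, ← dist_eq_norm]
        exact ENNReal.ofReal_le_ofReal (hd z hz)
    _ = ENNReal.ofReal d * ∫⁻ t in Set.Ioc (0 : ℝ) 1,
          ∫⁻ z in B, ‖fderiv ℝ φ (x + t • (z - x))‖ₑ ∂μ := by
        rw [lintegral_const_mul _ hm.lintegral_prod_right', lintegral_lintegral_swap]
        exact hm.aemeasurable
    _ ≤ ENNReal.ofReal d * ∫⁻ t in Set.Ioc (0 : ℝ) 1, ENNReal.ofReal (t ^ (-(n / p) : ℝ)) * K := by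
        exact mul_le_mul' le_rfl (setLIntegral_mono' measurableSet_Ioc ht)
    _ = _ := by
        rw [lintegral_mul_const _ (by fun_prop), hint]

end FiniteDimensional

lemma enorm_gradient {F : Type*} [NormedAddCommGroup F] [InnerProductSpace ℝ F] [CompleteSpace F]
    (f : F → ℝ) (x : F) : ‖gradient f x‖ₑ = ‖fderiv ℝ f x‖ₑ := by
  rw [gradient, LinearIsometryEquiv.enorm_map]

lemma continuous_gradient {F : Type*} [NormedAddCommGroup F] [InnerProductSpace ℝ F]
    [CompleteSpace F] {f : F → ℝ} (hf : ContDiff ℝ ∞ f) : Continuous (gradient f) :=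
  (InnerProductSpace.toDual ℝ F).symm.continuous.comp (hf.continuous_fderiv (by simp))

/-! ### From inequalities for test functions to eigenvalue bounds. -/

section DirichletSpace

variable {N : ℕ} {Ω : Set (EuclideanSpace ℝ (Fin N))}

lemma IsTestFunction.fderiv_eq_zero {φ : EuclideanSpace ℝ (Fin N) → ℝ} (h : IsTestFunction Ω φ)
    {x : EuclideanSpace ℝ (Fin N)} (hx : x ∉ Ω) : fderiv ℝ φ x = 0 := by
  by_contra h0
  exact hx (h.2.2 (support_fderiv_subset ℝ h0))

lemma IsTestFunction.eq_zero {φ : EuclideanSpace ℝ (Fin N) → ℝ} (h : IsTestFunction Ω φ)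
    {x : EuclideanSpace ℝ (Fin N)} (hx : x ∉ Ω) : φ x = 0 :=
  image_eq_zero_of_notMem_tsupport fun h' => hx (h.2.2 h')

lemma IsTestFunction.lintegral_fderiv {φ : EuclideanSpace ℝ (Fin N) → ℝ}
    (h : IsTestFunction Ω φ) {p : ℝ} (hp : 0 < p) (hΩ : MeasurableSet Ω) :
    ∫⁻ x in Ω, ‖fderiv ℝ φ x‖ₑ ^ p = ∫⁻ x, ‖fderiv ℝ φ x‖ₑ ^ p := by
  rw [← lintegral_indicator hΩ]
  refine lintegral_congr fun x => ?_
  by_cases hx : x ∈ Ω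
  · simp [hx]
  · rw [Set.indicator_of_notMem hx, h.fderiv_eq_zero hx, ← ofReal_norm, norm_zero,
      ENNReal.ofReal_zero, ENNReal.zero_rpow_of_pos hp]

lemma eLpNorm_rpow_eq_lintegral {α F : Type*} [MeasurableSpace α] [NormedAddCommGroup F]
    (μ : Measure α) (f : α → F) {p : ℝ} (hp : 0 < p) :
    eLpNorm f (ENNReal.ofReal p) μ ^ p = ∫⁻ x, ‖f x‖ₑ ^ p ∂μ := by
  rw [eLpNorm_eq_lintegral_rpow_enorm_toReal (by simpa using hp) ENNReal.ofReal_ne_top,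
    ENNReal.toReal_ofReal hp.le, ← ENNReal.rpow_mul, one_div_mul_cancel hp.ne', ENNReal.rpow_one]

/-- Elements of `W_0^{1,p}` are limits, almost everywhere and in norm, of test functions. -/
lemma MemW01p.exists_seq {p : ℝ} (hp : 1 < p) {u : EuclideanSpace ℝ (Fin N) → ℝ}
    {G : EuclideanSpace ℝ (Fin N) → EuclideanSpace ℝ (Fin N)} (h : MemW01p p Ω u G) :
    ∃ φ : ℕ → EuclideanSpace ℝ (Fin N) → ℝ, (∀ n, IsTestFunction Ω (φ n)) ∧
      (∀ᵐ x ∂(volume.restrict Ω), Filter.Tendsto (fun n => φ n x) Filter.atTop (nhds (u x))) ∧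
      Filter.Tendsto (fun n => ∫⁻ x in Ω, ‖φ n x‖ₑ ^ p) Filter.atTop
        (nhds (∫⁻ x in Ω, ‖u x‖ₑ ^ p)) ∧
      Filter.Tendsto (fun n => ∫⁻ x in Ω, ‖fderiv ℝ (φ n) x‖ₑ ^ p) Filter.atTop
        (nhds (∫⁻ x in Ω, ‖G x‖ₑ ^ p)) := by
  have hp0 : 0 < p := by linarith
  obtain ⟨⟨hu, hG, -⟩, hap⟩ := h
  have hε : Filter.Tendsto (fun n : ℕ => ENNReal.ofReal (1 / ((n : ℝ) + 1))) Filter.atTop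
      (nhds 0) := by
    simpa using ENNReal.tendsto_ofReal (tendsto_one_div_add_atTop_nhds_zero_nat (𝕜 := ℝ))
  choose φ hφ h1 h2 using fun n : ℕ => hap (1 / ((n : ℝ) + 1)) (by positivity)
  have hφm : ∀ n, AEStronglyMeasurable (φ n) (volume.restrict Ω) :=
    fun n => (hφ n).1.continuous.aestronglyMeasurable
  have hgm : ∀ n, AEStronglyMeasurable (gradient (φ n)) (volume.restrict Ω) :=
    fun n => (continuous_gradient (hφ n).1).aestronglyMeasurable
  have hp1 : (1 : ENNReal) ≤ ENNReal.ofReal p := by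
    rw [← ENNReal.ofReal_one]; exact ENNReal.ofReal_le_ofReal hp.le
  have key : ∀ {F : Type} [NormedAddCommGroup F] (v : EuclideanSpace ℝ (Fin N) → F)
      (f : ℕ → EuclideanSpace ℝ (Fin N) → F), MemLp v (ENNReal.ofReal p) (volume.restrict Ω) →
      (∀ n, AEStronglyMeasurable (f n) (volume.restrict Ω)) →
      (∀ n, eLpNorm (v - f n) (ENNReal.ofReal p) (volume.restrict Ω)
        ≤ ENNReal.ofReal (1 / ((n : ℝ) + 1))) →
      Filter.Tendsto (fun n => ∫⁻ x in Ω, ‖f n x‖ₑ ^ p) Filter.atTop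
        (nhds (∫⁻ x in Ω, ‖v x‖ₑ ^ p)) := by
    intro F _ v f hv hf hvf
    simp_rw [← eLpNorm_rpow_eq_lintegral _ _ hp0]
    refine (ENNReal.continuous_rpow_const.tendsto _).comp ?_
    have hlow := ENNReal.Tendsto.sub (tendsto_const_nhds (x := eLpNorm v (ENNReal.ofReal p)
      (volume.restrict Ω))) hε (Or.inl hv.2.ne)
    have hup := (tendsto_const_nhds (x := eLpNorm v (ENNReal.ofReal p)
      (volume.restrict Ω))).add hε
    rw [tsub_zero] at hlow
    rw [add_zero] at hup
    refine tendsto_of_tendsto_of_tendsto_of_le_of_le hlow hup (fun n => ?_) fun n => ?_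
    · refine tsub_le_iff_right.2 ?_
      calc eLpNorm v (ENNReal.ofReal p) (volume.restrict Ω)
          = eLpNorm (f n + (v - f n)) (ENNReal.ofReal p) (volume.restrict Ω) := by simp
        _ ≤ _ := (eLpNorm_add_le (hf n) (hv.1.sub (hf n)) hp1).trans (by gcongr; exact hvf n)
    · calc eLpNorm (f n) (ENNReal.ofReal p) (volume.restrict Ω)
          = eLpNorm (v - (v - f n)) (ENNReal.ofReal p) (volume.restrict Ω) := by simp
        _ ≤ _ := (eLpNorm_sub_le hv.1 (hv.1.sub (hf n)) hp1).trans (by gcongr; exact hvf n)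
  have hconv : Filter.Tendsto (fun n => eLpNorm (φ n - u) (ENNReal.ofReal p)
      (volume.restrict Ω)) Filter.atTop (nhds 0) := by
    refine tendsto_of_tendsto_of_tendsto_of_le_of_le tendsto_const_nhds hε
      (fun _ => zero_le) fun n => ?_
    rw [eLpNorm_sub_comm]
    exact h1 n
  obtain ⟨ns, hns, hae⟩ := (tendstoInMeasure_of_tendsto_eLpNorm (by simpa using hp0) hφm hu.1
    hconv).exists_seq_tendsto_ae
  refine ⟨fun n => φ (ns n), fun n => hφ _, hae,
    (key u φ hu hφm h1).comp hns.tendsto_atTop, ?_⟩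
  have := (key G (fun n => gradient (φ n)) hG hgm h2).comp hns.tendsto_atTop
  simpa only [Function.comp_def, enorm_gradient] using this

/-- A weighted Poincaré inequality extends from test functions to `W_0^{1,p}`. -/
lemma MemW01p.lintegral_weight_le {p : ℝ} (hp : 1 < p) {u : EuclideanSpace ℝ (Fin N) → ℝ}
    {G : EuclideanSpace ℝ (Fin N) → EuclideanSpace ℝ (Fin N)} (h : MemW01p p Ω u G)
    {W : EuclideanSpace ℝ (Fin N) → ENNReal} (hW : AEMeasurable W (volume.restrict Ω))
    (hWtop : ∀ x, W x ≠ ⊤)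
    {A : ENNReal} (hA : A ≠ ⊤)
    (hle : ∀ φ, IsTestFunction Ω φ →
      ∫⁻ x in Ω, W x * ‖φ x‖ₑ ^ p ≤ A * ∫⁻ x in Ω, ‖fderiv ℝ φ x‖ₑ ^ p) :
    ∫⁻ x in Ω, W x * ‖u x‖ₑ ^ p ≤ A * ∫⁻ x in Ω, ‖G x‖ₑ ^ p := by
  obtain ⟨φ, hφ, hae, -, hG⟩ := h.exists_seq hp
  -- Fatou: the weighted integrals of the approximations are not known to converge, but almost
  -- everywhere convergence suffices for this direction. Finiteness of `W` keeps multiplication by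
  -- it continuous at zeros of `u`.
  calc ∫⁻ x in Ω, W x * ‖u x‖ₑ ^ p
      ≤ ∫⁻ x in Ω, Filter.liminf (fun n => W x * ‖φ n x‖ₑ ^ p) Filter.atTop := by
        refine lintegral_mono_ae ?_
        filter_upwards [hae] with x hx
        refine le_of_eq (Filter.Tendsto.liminf_eq ?_).symm
        exact ENNReal.Tendsto.const_mul ((ENNReal.continuous_rpow_const.tendsto _).comp
          ((continuous_enorm.tendsto _).comp hx)) (Or.inr (hWtop x))
    _ ≤ Filter.liminf (fun n => ∫⁻ x in Ω, W x * ‖φ n x‖ₑ ^ p) Filter.atTop :=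
        lintegral_liminf_le' fun n => hW.mul
          ((hφ n).1.continuous.enorm.measurable.pow_const p).aemeasurable
    _ ≤ Filter.liminf (fun n => A * ∫⁻ x in Ω, ‖fderiv ℝ (φ n) x‖ₑ ^ p) Filter.atTop :=
        Filter.liminf_le_liminf (Filter.Eventually.of_forall fun n => hle _ (hφ n))
    _ = A * ∫⁻ x in Ω, ‖G x‖ₑ ^ p :=
        (ENNReal.Tendsto.const_mul hG (Or.inr hA)).liminf_eq

/-- A weighted Poincaré inequality for test functions bounds the first eigenvalue from below. -/
lemma inv_le_firstEigenvalue {p : ℝ} (hp : 1 < p)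
    {w : EuclideanSpace ℝ (Fin N) → ℝ} (hw : AEStronglyMeasurable w (volume.restrict Ω))
    {A : ENNReal} (hle : A ≠ ⊤ → ∀ φ, IsTestFunction Ω φ →
      ∫⁻ x in Ω, ‖w x‖ₑ * ‖φ x‖ₑ ^ p ≤ A * ∫⁻ x in Ω, ‖fderiv ℝ φ x‖ₑ ^ p)
    (hzero : ∀ u G, MemW01p p Ω u G → ∫⁻ x in Ω, ‖G x‖ₑ ^ p = 0 → u =ᵐ[volume.restrict Ω] 0) :
    A⁻¹ ≤ firstEigenvalue p Ω w := by
  have hp0 : 0 < p := by linarith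
  rcases eq_or_ne A ⊤ with rfl | hA
  · simp
  refine le_iInf₂ fun l hl => ?_
  obtain ⟨hl0, u, G, huG, hu, heq⟩ := hl
  have hEtop : ∫⁻ x in Ω, ‖G x‖ₑ ^ p ≠ ⊤ := by
    rw [← eLpNorm_rpow_eq_lintegral _ _ hp0]
    exact ENNReal.rpow_ne_top_of_nonneg hp0.le huG.1.2.1.2.ne
  have hE0 : ∫⁻ x in Ω, ‖G x‖ₑ ^ p ≠ 0 := fun h0 => hu (hzero u G huG h0)
  have hineq := huG.lintegral_weight_le hp hw.enorm (fun _ => enorm_ne_top) hA (hle hA)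
  have h := heq u G huG
  -- Where the gradient vanishes, the factor with exponent `p - 2` has no meaning for `p < 2`; the
  -- inner product is zero there, so its default value is harmless.
  have e1 : ∀ x, ‖G x‖ ^ (p - 2) * inner ℝ (G x) (G x) = ‖G x‖ ^ p := by
    intro x
    rw [real_inner_self_eq_norm_sq]
    rcases (norm_nonneg (G x)).eq_or_lt with h0 | h0
    · rw [← h0, Real.zero_rpow hp0.ne']; simp
    · rw [← Real.rpow_natCast, ← Real.rpow_add h0]; norm_num
  have e2 : ∀ x, w x * |u x| ^ (p - 2) * u x * u x = w x * |u x| ^ p := by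
    intro x
    rcases (abs_nonneg (u x)).eq_or_lt with h0 | h0
    · rw [← h0, Real.zero_rpow hp0.ne', abs_eq_zero.1 h0.symm]; simp
    · rw [mul_assoc, mul_assoc, ← abs_mul_abs_self (u x), ← sq, ← Real.rpow_natCast |u x| 2,
        ← Real.rpow_add h0]; norm_num
  simp_rw [e1, e2] at h
  have hEle : ∫⁻ x in Ω, ‖G x‖ₑ ^ p ≤
      ENNReal.ofReal l * ∫⁻ x in Ω, ‖w x‖ₑ * ‖u x‖ₑ ^ p := by
    calc ∫⁻ x in Ω, ‖G x‖ₑ ^ p = ‖∫ x in Ω, ‖G x‖ ^ p‖ₑ := by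
          have hn : ∀ x, ‖G x‖ₑ ^ p = ENNReal.ofReal (‖G x‖ ^ p) := fun x => by
            rw [← ENNReal.ofReal_rpow_of_nonneg (norm_nonneg _) hp0.le, ofReal_norm]
          simp_rw [hn] at hEtop ⊢
          rw [Real.enorm_of_nonneg (integral_nonneg fun x => by positivity),
            integral_eq_lintegral_of_nonneg_ae
              (Filter.Eventually.of_forall fun x => by positivity)
              (huG.1.2.1.1.norm.aemeasurable.pow_const p).aestronglyMeasurable,
            ENNReal.ofReal_toReal hEtop]
      _ = ENNReal.ofReal l * ‖∫ x in Ω, w x * |u x| ^ p‖ₑ := by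
          rw [h, enorm_mul, Real.enorm_of_nonneg hl0.le]
      -- No integrability of `w |u|^p` is required: the bound also holds for the default value `0`
      -- of the integral.
      _ ≤ _ := by
          refine mul_le_mul' le_rfl ((enorm_integral_le_lintegral_enorm _).trans (le_of_eq ?_))
          refine lintegral_congr fun x => ?_
          rw [enorm_mul, Real.enorm_of_nonneg (by positivity : 0 ≤ |u x| ^ p),
            ← ENNReal.ofReal_rpow_of_nonneg (abs_nonneg _) hp0.le, ← Real.norm_eq_abs,
            ofReal_norm]
  have hfin : 1 ≤ ENNReal.ofReal l * A := by
    by_contra! hlt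
    refine absurd (hEle.trans (mul_le_mul' le_rfl hineq)) (not_le.2 ?_)
    rw [← mul_assoc]
    calc _ < 1 * ∫⁻ x in Ω, ‖G x‖ₑ ^ p := (ENNReal.mul_lt_mul_iff_left hE0 hEtop).2 hlt
      _ = _ := one_mul _
  rw [← one_div]
  exact ENNReal.div_le_of_le_mul hfin

end DirichletSpace

/-! ### Sobolev's inequality, capacity and cutoffs. -/

section Inequalities

variable {N : ℕ}

/-- Tonelli: a point `z` lies in the ball about `x` for a set of centres `x` of the measure of one
ball. This averaging replaces a covering with bounded overlap. -/
lemma lintegral_setLIntegral_ball {E : Type*} [NormedAddCommGroup E] [NormedSpace ℝ E]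
    [MeasurableSpace E] [BorelSpace E] [FiniteDimensional ℝ E] (μ : Measure E)
    [μ.IsAddHaarMeasure] {f : E → ENNReal} (hf : Measurable f) (r : ℝ) :
    ∫⁻ x, ∫⁻ z in Metric.ball x r, f z ∂μ ∂μ = μ (Metric.ball 0 r) * ∫⁻ z, f z ∂μ := by
  have hS : MeasurableSet {q : E × E | dist q.2 q.1 < r} :=
    (isOpen_lt (by fun_prop) (by fun_prop)).measurableSet
  have hm : Measurable ({q : E × E | dist q.2 q.1 < r}.indicator fun q => f q.2) :=
    (hf.comp measurable_snd).indicator hS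
  calc ∫⁻ x, ∫⁻ z in Metric.ball x r, f z ∂μ ∂μ
      = ∫⁻ x, ∫⁻ z, {q : E × E | dist q.2 q.1 < r}.indicator (fun q => f q.2) (x, z) ∂μ ∂μ := by
        refine lintegral_congr fun x => ?_
        rw [← lintegral_indicator Metric.isOpen_ball.measurableSet]
        rfl
    _ = ∫⁻ z, ∫⁻ x, {q : E × E | dist q.2 q.1 < r}.indicator (fun q => f q.2) (x, z) ∂μ ∂μ :=
        lintegral_lintegral_swap hm.aemeasurable
    _ = ∫⁻ z, μ (Metric.ball 0 r) * f z ∂μ := by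
        refine lintegral_congr fun z => ?_
        rw [← Measure.addHaar_ball_center μ z r, mul_comm, ← lintegral_indicator_const
          Metric.isOpen_ball.measurableSet]
        refine lintegral_congr fun x => ?_
        simp only [Set.indicator, Set.mem_ofPred_eq, Metric.mem_ball, dist_comm]
    _ = _ := lintegral_const_mul _ hf

/-- The Sobolev inequality, in terms of integrals. -/
lemma exists_sobolev_const {p : ℝ} (hp : 1 < p) (hpN : p < N) :
    ∃ S : NNReal, 0 < S ∧ ∀ φ : EuclideanSpace ℝ (Fin N) → ℝ, ContDiff ℝ 1 φ →
      HasCompactSupport φ →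
      (∫⁻ x, ‖φ x‖ₑ ^ (N * p / (N - p))) ^ (1 - p / N) ≤ S * ∫⁻ x, ‖fderiv ℝ φ x‖ₑ ^ p := by
  have hp0 : 0 < p := by linarith
  have hN : (0 : ℝ) < N := by linarith
  have hNp : (0 : ℝ) < N - p := by linarith
  have hq : 0 < N * p / (N - p) := by positivity
  set K := SNormLESNormFDerivOfEqConst ℝ (volume : Measure (EuclideanSpace ℝ (Fin N)))
    (p.toNNReal : ℝ) with hK
  -- The added `1` makes the constant positive, so that one can divide by it later.
  refine ⟨K ^ p + 1, by positivity, fun φ hφ hc => ?_⟩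
  have h := eLpNorm_le_eLpNorm_fderiv_of_eq (volume : Measure (EuclideanSpace ℝ (Fin N)))
    hφ hc (p := p.toNNReal) (p' := (N * p / (N - p)).toNNReal)
    (by rw [← Real.toNNReal_one]; exact Real.toNNReal_le_toNNReal hp.le)
    (by rw [finrank_euclideanSpace_fin]; exact_mod_cast hN)
    (by
      rw [finrank_euclideanSpace_fin, NNReal.coe_inv, Real.coe_toNNReal _ hq.le,
        Real.coe_toNNReal _ hp0.le]
      field_simp)
  have h' := ENNReal.rpow_le_rpow h hp0.le
  rw [ENNReal.mul_rpow_of_nonneg _ _ hp0.le] at h'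
  change eLpNorm φ (ENNReal.ofReal _) volume ^ p ≤
    _ * eLpNorm (fderiv ℝ φ) (ENNReal.ofReal p) volume ^ p at h'
  rw [eLpNorm_rpow_eq_lintegral _ _ hp0] at h'
  have e : (1 - p / N : ℝ) = 1 / (N * p / (N - p)) * p := by field_simp
  rw [e, ENNReal.rpow_mul, ← eLpNorm_rpow_eq_lintegral _ _ hq, ← ENNReal.rpow_mul _ _ (1 / _),
    mul_one_div_cancel hq.ne', ENNReal.rpow_one]
  refine h'.trans (mul_le_mul' ?_ le_rfl)
  rw [← ENNReal.coe_rpow_of_nonneg _ hp0.le]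
  exact_mod_cast le_self_add

/-- The Poincaré inequality on a set of finite measure that follows from a Sobolev inequality. -/
lemma setLIntegral_rpow_le_of_sobolev {p : ℝ} (hp : 1 < p) (hpN : p < N)
    {φ : EuclideanSpace ℝ (Fin N) → ℝ} (hφ : Continuous φ) {D : ENNReal}
    (h : (∫⁻ x, ‖φ x‖ₑ ^ (N * p / (N - p))) ^ (1 - p / N) ≤ D)
    (B : Set (EuclideanSpace ℝ (Fin N))) :
    ∫⁻ x in B, ‖φ x‖ₑ ^ p ≤ volume B ^ (p / N) * D := by
  have hN : (0 : ℝ) < N := by linarith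
  have hNp : (0 : ℝ) < N - p := by linarith
  have h1 := ENNReal.lintegral_mul_norm_pow_le (μ := volume.restrict B)
    (hφ.enorm.measurable.pow_const (N * p / (N - p))).aemeasurable
    (aemeasurable_const (b := (1 : ENNReal))) (p := 1 - p / N) (q := p / N)
    (by rw [sub_nonneg, div_le_one hN]; exact hpN.le) (by positivity) (by ring)
  have e : ∀ x, (‖φ x‖ₑ ^ (N * p / (N - p))) ^ (1 - p / N) = ‖φ x‖ₑ ^ p := by
    intro x
    rw [← ENNReal.rpow_mul]
    congr 1
    field_simp
  simp only [e, ENNReal.one_rpow, mul_one, lintegral_const, Measure.restrict_apply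
    MeasurableSet.univ, Set.univ_inter, one_mul] at h1
  refine h1.trans ?_
  rw [mul_comm]
  gcongr
  refine (ENNReal.rpow_le_rpow (setLIntegral_le_lintegral _ _) ?_).trans h
  rw [sub_nonneg, div_le_one hN]; exact hpN.le

lemma lintegral_ofReal_norm_gradient {p : ℝ} (hp : 0 ≤ p)
    (φ : EuclideanSpace ℝ (Fin N) → ℝ) :
    ∫⁻ x, ENNReal.ofReal (‖gradient φ x‖ ^ p) = ∫⁻ x, ‖fderiv ℝ φ x‖ₑ ^ p := by
  refine lintegral_congr fun x => ?_
  rw [← ENNReal.ofReal_rpow_of_nonneg (norm_nonneg _) hp, ofReal_norm, enorm_gradient]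

/-- A Sobolev inequality bounds capacities from below by volumes. -/
lemma volume_rpow_le_mul_pCapacity {p : ℝ} (hp : 1 < p) (hpN : p < N) {S : NNReal}
    (hS0 : 0 < S)
    (hS : ∀ φ : EuclideanSpace ℝ (Fin N) → ℝ, ContDiff ℝ 1 φ → HasCompactSupport φ →
      (∫⁻ x, ‖φ x‖ₑ ^ (N * p / (N - p))) ^ (1 - p / N) ≤ S * ∫⁻ x, ‖fderiv ℝ φ x‖ₑ ^ p)
    {K : Set (EuclideanSpace ℝ (Fin N))} (hK : MeasurableSet K)
    (D : Set (EuclideanSpace ℝ (Fin N))) :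
    volume K ^ (1 - p / N) ≤ S * pCapacity p K D := by
  have hN : (0 : ℝ) < N := by linarith
  have hNp : (0 : ℝ) < N - p := by linarith
  rw [mul_comm, ← ENNReal.div_le_iff_le_mul (Or.inl (by exact_mod_cast hS0.ne')) (Or.inl ENNReal.coe_ne_top)]
  refine le_iInf₂ fun φ hφ => ?_
  rw [ENNReal.div_le_iff_le_mul (Or.inl (by exact_mod_cast hS0.ne')) (Or.inl ENNReal.coe_ne_top),
    lintegral_ofReal_norm_gradient (by linarith), mul_comm]
  refine le_trans (ENNReal.rpow_le_rpow ?_ ?_) (hS φ (hφ.1.1.of_le (by simp)) hφ.1.2.1)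
  · rw [← setLIntegral_one]
    refine (setLIntegral_mono' hK fun x hx => ?_).trans (setLIntegral_le_lintegral K _)
    refine ENNReal.one_le_rpow ?_ (by positivity)
    have h1 := hφ.2 x hx
    rw [Real.enorm_of_nonneg (by linarith), ← ENNReal.ofReal_one]
    exact ENNReal.ofReal_le_ofReal h1
  · rw [sub_nonneg, div_le_one hN]; exact hpN.le

/-- Cutoff functions between concentric balls. -/
lemma exists_cutoff (N : ℕ) : ∃ M : ℝ, 0 ≤ M ∧ ∀ (y : EuclideanSpace ℝ (Fin N)) (r : ℝ), 0 < r →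
    ∃ η : EuclideanSpace ℝ (Fin N) → ℝ, IsTestFunction (Metric.ball y (2 * r)) η ∧
      (∀ x ∈ Metric.closedBall y r, η x = 1) ∧ (∀ x, 0 ≤ η x ∧ η x ≤ 1) ∧
      ∀ x, ‖fderiv ℝ η x‖ ≤ M / r := by
  -- The outer radius `3/2` is below `2`, so that the closed support fits in the open ball of twice
  -- the radius.
  let b : ContDiffBump (0 : EuclideanSpace ℝ (Fin N)) := ⟨1, 3 / 2, by norm_num, by norm_num⟩
  have hbs : ContDiff ℝ 1 b := b.contDiff
  obtain ⟨M, hM⟩ := (b.hasCompactSupport.fderiv (𝕜 := ℝ)).exists_bound_of_continuous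
    (hbs.continuous_fderiv one_ne_zero)
  refine ⟨M, (norm_nonneg _).trans (hM 0), fun y r hr => ?_⟩
  have hnorm : ∀ x, ‖r⁻¹ • (x - y)‖ = dist x y / r := by
    intro x
    rw [norm_smul, norm_inv, Real.norm_of_nonneg hr.le, dist_eq_norm]
    ring
  have hsub : tsupport (fun x => b (r⁻¹ • (x - y))) ⊆ Metric.closedBall y (3 / 2 * r) := by
    refine closure_minimal (fun x hx => ?_) Metric.isClosed_closedBall
    have : r⁻¹ • (x - y) ∈ Function.support b := hx
    rw [b.support_eq, mem_ball_zero_iff, hnorm, div_lt_iff₀ hr] at this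
    exact this.le
  refine ⟨fun x => b (r⁻¹ • (x - y)), ⟨b.contDiff.comp (by fun_prop), ?_, ?_⟩, ?_, ?_, ?_⟩
  · exact (isCompact_closedBall y (3 / 2 * r)).of_isClosed_subset (isClosed_tsupport _) hsub
  · exact hsub.trans (Metric.closedBall_subset_ball (by linarith))
  · intro x hx
    refine b.one_of_mem_closedBall ?_
    rw [mem_closedBall_zero_iff, hnorm, div_le_iff₀ hr]
    simpa [b] using hx
  · exact fun x => ⟨b.nonneg, b.le_one⟩
  · intro x
    have h1 : HasFDerivAt (fun x : EuclideanSpace ℝ (Fin N) => r⁻¹ • (x - y))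
        (r⁻¹ • ContinuousLinearMap.id ℝ (EuclideanSpace ℝ (Fin N))) x :=
      ((hasFDerivAt_id x).sub_const y).const_smul r⁻¹
    have h2 := ((hbs.differentiable one_ne_zero (r⁻¹ • (x - y))).hasFDerivAt).comp x h1
    have h3 : fderiv ℝ (fun x => b (r⁻¹ • (x - y))) x = _ := h2.fderiv
    rw [h3, ContinuousLinearMap.comp_smul, ContinuousLinearMap.comp_id, norm_smul, norm_inv,
      Real.norm_of_nonneg hr.le, div_eq_inv_mul]
    gcongr
    exact hM _

/-- Maz'ya's argument: a value of a function that vanishes on `F`, times the capacity of `F`, is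
controlled by the energy and the oscillation of the function. -/
lemma exists_enorm_rpow_mul_pCapacity_le (N : ℕ) {p : ℝ} (hp : 1 < p) :
    ∃ M : ℝ, 0 ≤ M ∧ ∀ (φ : EuclideanSpace ℝ (Fin N) → ℝ) (F : Set (EuclideanSpace ℝ (Fin N))),
      ContDiff ℝ ∞ φ → (∀ x ∈ F, φ x = 0) →
      ∀ (y z : EuclideanSpace ℝ (Fin N)) (r : ℝ), 0 < r →
      ‖φ z‖ₑ ^ p * pCapacity p (F ∩ Metric.closedBall y r) (Metric.ball y (2 * r)) ≤
        2 ^ (p - 1) * ((∫⁻ x in Metric.ball y (2 * r), ‖fderiv ℝ φ x‖ₑ ^ p) +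
          ENNReal.ofReal (M / r) ^ p *
            ∫⁻ x in Metric.ball y (2 * r), ‖φ x - φ z‖ₑ ^ p) := by
  obtain ⟨M, hM0, hM⟩ := exists_cutoff N
  refine ⟨M, hM0, fun φ F hφ hF y z r hr => ?_⟩
  have hp0 : 0 < p := by linarith
  obtain ⟨η, ⟨hη, hηc, hηs⟩, hη1, hη01, hηd⟩ := hM y r hr
  rcases eq_or_ne (φ z) 0 with hz | hz
  · simp [hz, hp0]
  -- The competitor `η (1 - φ/φ(z))` equals `1` on `F` in the closed ball, and `φ(z)` times its
  -- gradient is `-η ∇φ + (φ(z) - φ) ∇η`, which involves only the energy and the oscillation.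
  have hs : tsupport (fun x => η x * (1 - (φ z)⁻¹ * φ x)) ⊆ tsupport η :=
    tsupport_mul_subset_left
  have hψ : IsTestFunction (Metric.ball y (2 * r)) (fun x => η x * (1 - (φ z)⁻¹ * φ x)) :=
    ⟨hη.mul (contDiff_const.sub (contDiff_const.mul hφ)), hηc.mul_right, hs.trans hηs⟩
  have hcap : pCapacity p (F ∩ Metric.closedBall y r) (Metric.ball y (2 * r)) ≤
      ∫⁻ x, ‖fderiv ℝ (fun x => η x * (1 - (φ z)⁻¹ * φ x)) x‖ₑ ^ p := by
    rw [← lintegral_ofReal_norm_gradient hp0.le]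
    refine iInf₂_le _ ⟨hψ, fun x hx => ?_⟩
    simp [hη1 x hx.2, hF x hx.1]
  rw [← hψ.lintegral_fderiv hp0 Metric.isOpen_ball.measurableSet] at hcap
  have hpt : ∀ x, ‖φ z‖ₑ ^ p * ‖fderiv ℝ (fun x => η x * (1 - (φ z)⁻¹ * φ x)) x‖ₑ ^ p ≤
      2 ^ (p - 1) * (‖fderiv ℝ φ x‖ₑ ^ p + ENNReal.ofReal (M / r) ^ p * ‖φ x - φ z‖ₑ ^ p) := by
    intro x
    have hd : HasFDerivAt (fun x => η x * (1 - (φ z)⁻¹ * φ x))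
        (η x • -((φ z)⁻¹ • fderiv ℝ φ x) + (1 - (φ z)⁻¹ * φ x) • fderiv ℝ η x) x :=
      ((hη.differentiable (by simp) x).hasFDerivAt).mul
        ((((hφ.differentiable (by simp) x).hasFDerivAt).const_mul _).const_sub 1)
    have hn : ‖φ z‖ * ‖fderiv ℝ (fun x => η x * (1 - (φ z)⁻¹ * φ x)) x‖ ≤
        ‖fderiv ℝ φ x‖ + M / r * ‖φ x - φ z‖ := by
      rw [hd.fderiv, ← norm_smul, smul_add, smul_smul, smul_smul, smul_neg, smul_smul]
      refine (norm_add_le _ _).trans (add_le_add ?_ ?_)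
      · rw [norm_neg, norm_smul]
        refine mul_le_of_le_one_left (norm_nonneg _) ?_
        have : φ z * η x * (φ z)⁻¹ = η x := by field_simp
        rw [this, Real.norm_of_nonneg (hη01 x).1]
        exact (hη01 x).2
      · have : φ z * (1 - (φ z)⁻¹ * φ x) = φ z - φ x := by field_simp
        rw [this, norm_smul, norm_sub_rev, mul_comm]
        gcongr
        exact hηd x
    have hn' : ‖φ z‖ₑ * ‖fderiv ℝ (fun x => η x * (1 - (φ z)⁻¹ * φ x)) x‖ₑ ≤
        ‖fderiv ℝ φ x‖ₑ + ENNReal.ofReal (M / r) * ‖φ x - φ z‖ₑ := by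
      have := ENNReal.ofReal_le_ofReal hn
      rwa [ENNReal.ofReal_mul (norm_nonneg _), ENNReal.ofReal_add (norm_nonneg _) (by positivity),
        ENNReal.ofReal_mul (by positivity), ofReal_norm, ofReal_norm, ofReal_norm,
        ofReal_norm] at this
    rw [← ENNReal.mul_rpow_of_nonneg _ _ hp0.le, ← ENNReal.mul_rpow_of_nonneg _ _ hp0.le]
    exact (ENNReal.rpow_le_rpow hn' hp0.le).trans (ENNReal.rpow_add_le_mul_rpow_add_rpow _ _ hp.le)
  have hm1 : Measurable fun x => ‖fderiv ℝ φ x‖ₑ ^ p :=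
    (hφ.continuous_fderiv (by simp)).enorm.measurable.pow_const p
  have hm2 : Measurable fun x => ‖φ x - φ z‖ₑ ^ p :=
    (hφ.continuous.sub continuous_const).enorm.measurable.pow_const p
  calc _ ≤ ‖φ z‖ₑ ^ p * ∫⁻ x in Metric.ball y (2 * r),
        ‖fderiv ℝ (fun x => η x * (1 - (φ z)⁻¹ * φ x)) x‖ₑ ^ p := by gcongr
    _ = ∫⁻ x in Metric.ball y (2 * r),
        ‖φ z‖ₑ ^ p * ‖fderiv ℝ (fun x => η x * (1 - (φ z)⁻¹ * φ x)) x‖ₑ ^ p := by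
      rw [lintegral_const_mul]
      exact (hψ.1.continuous_fderiv (by simp)).enorm.measurable.pow_const p
    _ ≤ ∫⁻ x in Metric.ball y (2 * r), 2 ^ (p - 1) * (‖fderiv ℝ φ x‖ₑ ^ p +
        ENNReal.ofReal (M / r) ^ p * ‖φ x - φ z‖ₑ ^ p) := lintegral_mono hpt
    _ = _ := by
      rw [lintegral_const_mul _ (by fun_prop), lintegral_add_left hm1,
        lintegral_const_mul _ hm2]

end Inequalities

/-! ### Poincaré inequality for fat complements, and Morrey's inequality. -/

section Poincare

variable {N : ℕ}

/-- The Poincaré inequality on balls centred on a uniformly fat zero set. -/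
lemma exists_setLIntegral_ball_le_of_fat {p : ℝ} (hp : 1 < p) (hpN : p < N) {c : ℝ}
    (hc : 0 < c) :
    ∃ K : ENNReal, K ≠ ⊤ ∧ ∀ (φ : EuclideanSpace ℝ (Fin N) → ℝ)
      (F : Set (EuclideanSpace ℝ (Fin N))), ContDiff ℝ ∞ φ → (∀ x ∈ F, φ x = 0) →
      IsUniformlyFat p c F → ∀ y ∈ F, ∀ r : ℝ, 0 < r →
      ∫⁻ z in Metric.ball y (2 * r), ‖φ z‖ₑ ^ p ≤
        K * ENNReal.ofReal r ^ p * ∫⁻ z in Metric.ball y (2 * r), ‖fderiv ℝ φ z‖ₑ ^ p := by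
  have hp0 : 0 < p := by linarith
  have hN : (0 : ℝ) < N := by linarith
  obtain ⟨S, hS0, hS⟩ := exists_sobolev_const hp hpN
  obtain ⟨M, hM0, hM⟩ := exists_enorm_rpow_mul_pCapacity_le N hp
  set β := volume (Metric.ball (0 : EuclideanSpace ℝ (Fin N)) 1) with hβ
  have hβ0 : β ≠ 0 := (Metric.measure_ball_pos _ _ one_pos).ne'
  have hβt : β ≠ ⊤ := measure_ball_lt_top.ne
  -- `4 * M` is the gradient bound `M / r` of the cutoff times the diameter bound `4 * r`, so the
  -- scale cancels; `2 ^ N` comes from the double-integral Poincaré inequality.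
  set T : ENNReal := 2 ^ (p - 1) * (1 + ENNReal.ofReal (4 * M) ^ p * 2 ^ N) with hT
  have hTt : T ≠ ⊤ := by
    refine ENNReal.mul_ne_top (ENNReal.rpow_ne_top_of_nonneg (by linarith) (by simp))
      (ENNReal.add_ne_top.2 ⟨by simp, ENNReal.mul_ne_top ?_ (by simp)⟩)
    exact ENNReal.rpow_ne_top_of_nonneg hp0.le ENNReal.ofReal_ne_top
  have hc0 : ENNReal.ofReal c ≠ 0 := by simpa using hc
  refine ⟨(ENNReal.ofReal c)⁻¹ * (S * T * 2 ^ N * β ^ (p / N)), ?_, ?_⟩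
  · refine ENNReal.mul_ne_top (ENNReal.inv_ne_top.2 hc0) (ENNReal.mul_ne_top (ENNReal.mul_ne_top
      (ENNReal.mul_ne_top ENNReal.coe_ne_top hTt) (by simp)) ?_)
    exact ENNReal.rpow_ne_top_of_nonneg (by positivity) hβt
  intro φ F hφ hF hfat y hy r hr
  set κ := pCapacity p (F ∩ Metric.closedBall y r) (Metric.ball y (2 * r)) with hκ
  set m := volume (Metric.closedBall y r) with hm
  have hmβ : m = ENNReal.ofReal r ^ (N : ℝ) * β := by
    rw [hm, Measure.addHaar_closedBall _ _ hr.le, finrank_euclideanSpace_fin,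
      ENNReal.ofReal_pow hr.le, ENNReal.rpow_natCast]
  have hm2 : volume (Metric.ball y (2 * r)) = 2 ^ N * m := by
    rw [Measure.addHaar_ball_of_pos _ _ (by positivity), hmβ, finrank_euclideanSpace_fin,
      ENNReal.ofReal_pow (by positivity), ENNReal.ofReal_mul (by norm_num), mul_pow,
      ENNReal.rpow_natCast, mul_assoc]
    norm_num [← hβ]
  have hm0 : m ≠ 0 := (Metric.measure_closedBall_pos _ _ hr).ne'
  have hmt : m ≠ ⊤ := measure_closedBall_lt_top.ne
  set B := Metric.ball y (2 * r) with hB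
  set D := ∫⁻ z in B, ‖fderiv ℝ φ z‖ₑ ^ p with hD
  set I := ∫⁻ z in B, ‖φ z‖ₑ ^ p with hI
  have hφm : Measurable fun z => ‖φ z‖ₑ ^ p := hφ.continuous.enorm.measurable.pow_const p
  have hdm : Measurable fun q : EuclideanSpace ℝ (Fin N) × EuclideanSpace ℝ (Fin N) =>
      ‖φ q.2 - φ q.1‖ₑ ^ p :=
    ((hφ.continuous.comp continuous_snd).sub
      (hφ.continuous.comp continuous_fst)).enorm.measurable.pow_const p
  have h1 : I * κ ≤ T * (2 ^ N * m * D) := by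
    calc I * κ = ∫⁻ z in B, ‖φ z‖ₑ ^ p * κ := (lintegral_mul_const _ hφm).symm
      _ ≤ ∫⁻ z in B, 2 ^ (p - 1) * (D + ENNReal.ofReal (M / r) ^ p *
            ∫⁻ x in B, ‖φ x - φ z‖ₑ ^ p) := lintegral_mono fun z => hM φ F hφ hF y z r hr
      _ = 2 ^ (p - 1) * (D * (2 ^ N * m) + ENNReal.ofReal (M / r) ^ p *
            ∫⁻ z in B, ∫⁻ x in B, ‖φ x - φ z‖ₑ ^ p) := by
          have hm1 : Measurable fun z => ∫⁻ x in B, ‖φ x - φ z‖ₑ ^ p := hdm.lintegral_prod_right'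
          rw [lintegral_const_mul _ (by fun_prop), lintegral_add_left measurable_const,
            lintegral_const_mul _ hm1, lintegral_const, Measure.restrict_apply MeasurableSet.univ,
            Set.univ_inter, hm2]
      _ ≤ 2 ^ (p - 1) * (D * (2 ^ N * m) + ENNReal.ofReal (M / r) ^ p *
            (ENNReal.ofReal (4 * r) ^ p * (2 ^ N * (2 ^ N * m) * D))) := by
          gcongr
          have := setLIntegral_setLIntegral_enorm_sub_le volume (hφ.of_le (by simp))
            (convex_ball y (2 * r)) Metric.isOpen_ball.measurableSet hp.le (d := 4 * r)
            (fun x hx z hz => by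
              rw [Metric.mem_ball] at hx hz
              linarith [dist_triangle_right z x y])
          rwa [finrank_euclideanSpace_fin, hm2] at this
      _ = T * (2 ^ N * m * D) := by
          have e : ENNReal.ofReal (4 * M) ^ p =
              ENNReal.ofReal (M / r) ^ p * ENNReal.ofReal (4 * r) ^ p := by
            rw [← ENNReal.mul_rpow_of_nonneg _ _ hp0.le, ← ENNReal.ofReal_mul (by positivity)]
            congr 2
            field_simp
          rw [hT, e]
          ring
  have h2 : ENNReal.ofReal c * m ^ (1 - p / N) ≤ S * κ := by
    calc ENNReal.ofReal c * m ^ (1 - p / N)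
        ≤ ENNReal.ofReal c * (S * pCapacity p (Metric.closedBall y r) B) := by
          gcongr
          exact volume_rpow_le_mul_pCapacity hp hpN hS0 hS Metric.isClosed_closedBall.measurableSet _
      _ = S * (ENNReal.ofReal c * pCapacity p (Metric.closedBall y r) B) := by ring
      _ ≤ S * κ := by
          gcongr
          exact hfat y hy r hr
  -- The capacity is at least of order `m^(1 - p/N)`, and multiplying by `m^(p/N)` lets a full
  -- factor `m` cancel. What remains, `m^(p/N)`, is of order `r^p`.
  have h3 : I * (ENNReal.ofReal c * m) ≤ S * T * 2 ^ N * m ^ (p / N) * D * m := by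
    have e : m = m ^ (1 - p / N) * m ^ (p / N) := by
      rw [← ENNReal.rpow_add _ _ hm0 hmt]; simp
    calc I * (ENNReal.ofReal c * m)
        = I * (ENNReal.ofReal c * m ^ (1 - p / N)) * m ^ (p / N) := by
          conv_lhs => rw [e]
          ring
      _ ≤ I * (S * κ) * m ^ (p / N) := by gcongr
      _ = S * (I * κ) * m ^ (p / N) := by ring
      _ ≤ S * (T * (2 ^ N * m * D)) * m ^ (p / N) := by gcongr
      _ = _ := by ring
  rw [← mul_assoc, ENNReal.mul_le_mul_iff_left hm0 hmt] at h3
  have h4 : m ^ (p / N) = ENNReal.ofReal r ^ p * β ^ (p / N) := by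
    rw [hmβ, ENNReal.mul_rpow_of_nonneg _ _ (by positivity), ← ENNReal.rpow_mul]
    congr 2
    field_simp
  calc I = (ENNReal.ofReal c)⁻¹ * (I * ENNReal.ofReal c) := by
        rw [mul_comm I, ← mul_assoc, ENNReal.inv_mul_cancel hc0 ENNReal.ofReal_ne_top, one_mul]
    _ ≤ (ENNReal.ofReal c)⁻¹ * (S * T * 2 ^ N * m ^ (p / N) * D) := by gcongr
    _ = _ := by rw [h4]; ring

/-- The Poincaré inequality for open sets with uniformly fat complement. -/
lemma exists_poincare_const_of_fat {p : ℝ} (hp : 1 < p) (hpN : p < N) {c : ℝ} (hc : 0 < c) :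
    ∃ K : ENNReal, K ≠ ⊤ ∧ ∀ (φ : EuclideanSpace ℝ (Fin N) → ℝ)
      (F : Set (EuclideanSpace ℝ (Fin N))), ContDiff ℝ ∞ φ → (∀ x ∈ F, φ x = 0) →
      IsUniformlyFat p c F → ∀ r : ℝ, 0 < r → (∀ x, ∃ y ∈ F, dist x y ≤ r) →
      ∫⁻ z, ‖φ z‖ₑ ^ p ≤ K * ENNReal.ofReal r ^ p * ∫⁻ z, ‖fderiv ℝ φ z‖ₑ ^ p := by
  have hp0 : 0 < p := by linarith
  obtain ⟨K, hK, h⟩ := exists_setLIntegral_ball_le_of_fat hp hpN hc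
  refine ⟨K * 3 ^ N, ENNReal.mul_ne_top hK (by simp), fun φ F hφ hF hfat r hr hdist => ?_⟩
  have hφm : Measurable fun z => ‖φ z‖ₑ ^ p := hφ.continuous.enorm.measurable.pow_const p
  have hgm : Measurable fun z => ‖fderiv ℝ φ z‖ₑ ^ p :=
    (hφ.continuous_fderiv (by simp)).enorm.measurable.pow_const p
  -- With `y` in `F` within `r` of `x`, the ball of radius `r` about `x` lies in the `2r`-ball about
  -- `y`, and that one in the `3r`-ball about `x`. The volume ratio gives the factor `3 ^ N`.
  have hloc : ∀ x, ∫⁻ z in Metric.ball x r, ‖φ z‖ₑ ^ p ≤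
      K * ENNReal.ofReal r ^ p * ∫⁻ z in Metric.ball x (3 * r), ‖fderiv ℝ φ z‖ₑ ^ p := by
    intro x
    obtain ⟨y, hy, hxy⟩ := hdist x
    refine (lintegral_mono_set (Metric.ball_subset_ball' (by linarith :
      r + dist x y ≤ 2 * r))).trans ((h φ F hφ hF hfat y hy r hr).trans ?_)
    gcongr
    exact Metric.ball_subset_ball' (by rw [dist_comm y x]; linarith)
  set m := volume (Metric.ball (0 : EuclideanSpace ℝ (Fin N)) r) with hm
  have hm0 : m ≠ 0 := (Metric.measure_ball_pos _ _ hr).ne'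
  have hmt : m ≠ ⊤ := measure_ball_lt_top.ne
  have hm3 : volume (Metric.ball (0 : EuclideanSpace ℝ (Fin N)) (3 * r)) = 3 ^ N * m := by
    rw [hm, Measure.addHaar_ball_of_pos _ _ (by positivity : 0 < 3 * r),
      Measure.addHaar_ball_of_pos _ _ hr, finrank_euclideanSpace_fin,
      ENNReal.ofReal_pow (by positivity), ENNReal.ofReal_mul (by norm_num), mul_pow, mul_assoc,
      ENNReal.ofReal_pow hr.le]
    norm_num
  have hint := lintegral_mono (μ := volume) hloc
  rw [lintegral_const_mul', lintegral_setLIntegral_ball _ hφm, lintegral_setLIntegral_ball _ hgm,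
    hm3] at hint
  · rw [← ENNReal.mul_le_mul_iff_right hm0 hmt]
    refine hint.trans (le_of_eq ?_)
    ring
  · exact ENNReal.mul_ne_top hK (ENNReal.rpow_ne_top_of_nonneg hp0.le ENNReal.ofReal_ne_top)

/-- Morrey's inequality. -/
lemma exists_morrey_const {p : ℝ} (hp : 1 < p) (hpN : N < p) :
    ∃ K : ENNReal, K ≠ ⊤ ∧ ∀ φ : EuclideanSpace ℝ (Fin N) → ℝ, ContDiff ℝ 1 φ →
      ∀ (x y : EuclideanSpace ℝ (Fin N)) (r : ℝ), 0 < r → dist x y ≤ r →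
      ‖φ x - φ y‖ₑ ^ p ≤ K * ENNReal.ofReal r ^ (p - N) * ∫⁻ z, ‖fderiv ℝ φ z‖ₑ ^ p := by
  have hp0 : 0 < p := by linarith
  set β := volume (Metric.ball (0 : EuclideanSpace ℝ (Fin N)) 1) with hβ
  have hβ0 : β ≠ 0 := (Metric.measure_ball_pos _ _ one_pos).ne'
  -- The `4` is two endpoints, each contributing the diameter `2r`.
  set b : ENNReal := 4 * ENNReal.ofReal (1 / (1 - N / p)) with hb
  have hbt : b ≠ ⊤ := ENNReal.mul_ne_top (by simp) ENNReal.ofReal_ne_top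
  refine ⟨b ^ p * β⁻¹, ENNReal.mul_ne_top (ENNReal.rpow_ne_top_of_nonneg hp0.le hbt)
    (ENNReal.inv_ne_top.2 hβ0), fun φ hφ x y r hr hxy => ?_⟩
  set R := ENNReal.ofReal r with hR
  have hR0 : R ≠ 0 := by simpa [hR] using hr
  have hRt : R ≠ ⊤ := ENNReal.ofReal_ne_top
  set B := Metric.closedBall x r with hB
  set m := volume B with hm
  have hm0 : m ≠ 0 := (Metric.measure_closedBall_pos _ _ hr).ne'
  have hmt : m ≠ ⊤ := measure_closedBall_lt_top.ne
  have hmβ : m = R ^ (N : ℝ) * β := by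
    rw [hm, hB, Measure.addHaar_closedBall _ _ hr.le, finrank_euclideanSpace_fin,
      ENNReal.ofReal_pow hr.le, ENNReal.rpow_natCast]
  set D := ∫⁻ z, ‖fderiv ℝ φ z‖ₑ ^ p with hD
  have hBm : MeasurableSet B := Metric.isClosed_closedBall.measurableSet
  have hside : ∀ v ∈ B, ∫⁻ z in B, ‖φ z - φ v‖ₑ ≤
      2 * R * (ENNReal.ofReal (1 / (1 - N / p)) * (D ^ (1 / p) * m ^ (1 - 1 / p))) := by
    intro v hv
    have h := setLIntegral_enorm_sub_le volume hφ (convex_closedBall x r) hBm (d := 2 * r)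
      hp.le (by rwa [finrank_euclideanSpace_fin]) hv (fun z hz => by
        rw [Metric.mem_closedBall] at hv hz
        linarith [dist_triangle_right z v x])
    rw [finrank_euclideanSpace_fin, ENNReal.ofReal_mul (by norm_num)] at h
    refine h.trans ?_
    norm_num
    gcongr
    exact setLIntegral_le_lintegral _ _
  have h1 : ‖φ x - φ y‖ₑ * m ≤ b * R * (D ^ (1 / p) * m ^ (1 - 1 / p)) := by
    calc ‖φ x - φ y‖ₑ * m = ∫⁻ _ in B, ‖φ x - φ y‖ₑ := by simp [hm]
      _ ≤ ∫⁻ z in B, (‖φ z - φ x‖ₑ + ‖φ z - φ y‖ₑ) := by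
          refine lintegral_mono fun z => ?_
          rw [enorm_sub_rev (φ z) (φ x)]
          calc ‖φ x - φ y‖ₑ = ‖(φ x - φ z) + (φ z - φ y)‖ₑ := by congr 1; ring
            _ ≤ _ := enorm_add_le _ _
      _ = (∫⁻ z in B, ‖φ z - φ x‖ₑ) + ∫⁻ z in B, ‖φ z - φ y‖ₑ :=
          lintegral_add_left (hφ.continuous.sub continuous_const).enorm.measurable _
      _ ≤ _ := add_le_add (hside x (Metric.mem_closedBall_self hr.le))
          (hside y (by rw [hB, Metric.mem_closedBall, dist_comm]; exact hxy))
      _ = _ := by rw [hb]; ring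
  clear_value b
  have h2 := ENNReal.rpow_le_rpow h1 hp0.le
  have hm1 : m ^ p = m * m ^ (p - 1) := by
    conv_rhs => enter [1]; rw [← ENNReal.rpow_one m]
    rw [← ENNReal.rpow_add _ _ hm0 hmt]
    congr 1
    ring
  have hmp : (m ^ (1 - 1 / p)) ^ p = m ^ (p - 1) := by
    rw [← ENNReal.rpow_mul]
    congr 1
    field_simp
  rw [ENNReal.mul_rpow_of_nonneg _ _ hp0.le, ENNReal.mul_rpow_of_nonneg _ _ hp0.le,
    ENNReal.mul_rpow_of_nonneg _ _ hp0.le, ENNReal.mul_rpow_of_nonneg _ _ hp0.le,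
    ← ENNReal.rpow_mul D, one_div_mul_cancel hp0.ne', ENNReal.rpow_one, hmp, hm1, ← mul_assoc,
    ← mul_assoc, ENNReal.mul_le_mul_iff_left
      (fun h => by rcases ENNReal.rpow_eq_zero_iff.1 h with h | h <;> simp_all)
      (ENNReal.rpow_ne_top_of_nonneg (by linarith) hmt)] at h2
  rw [← ENNReal.mul_le_mul_iff_left hm0 hmt]
  refine h2.trans (le_of_eq ?_)
  have hRp : R ^ p = R ^ (p - N) * R ^ (N : ℝ) := by
    rw [← ENNReal.rpow_add _ _ hR0 hRt]; simp
  have hββ : β⁻¹ * β = 1 := ENNReal.inv_mul_cancel hβ0 measure_ball_lt_top.ne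
  rw [hRp, hmβ]
  calc _ = b ^ p * (R ^ (p - N) * R ^ (N : ℝ)) * D * 1 := by ring
    _ = _ := by rw [← hββ]; ring

end Poincare

/-! ### Inner radius, interpolation, and triviality of functions with zero gradient. -/

section FirstEigenvalue

variable {N : ℕ} {Ω : Set (EuclideanSpace ℝ (Fin N))}

/-- Finite inner radius: the complement comes within the inner radius of every point. -/
lemma exists_dist_le_innerRadius (hΩ : IsOpen Ω) (h : innerRadius Ω ≠ ⊤)
    (x : EuclideanSpace ℝ (Fin N)) :
    ∃ y ∈ Ωᶜ, dist x y ≤ (innerRadius Ω).toReal := by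
  by_cases hx : x ∈ Ω
  · have hle : Metric.infEDist x Ωᶜ ≤ innerRadius Ω := le_iSup₂_of_le x hx le_rfl
    -- The distance to the empty set is `⊤`, so a finite inner radius excludes the whole space.
    have hc : (Ωᶜ).Nonempty := by
      by_contra h0
      rw [Set.not_nonempty_iff_eq_empty.1 h0, Metric.infEDist_empty] at hle
      exact h (top_le_iff.1 hle)
    obtain ⟨y, hy, hxy⟩ := hΩ.isClosed_compl.exists_infDist_eq_dist hc x
    exact ⟨y, hy, hxy ▸ ENNReal.toReal_mono h hle⟩
  · exact ⟨x, hx, by simp⟩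

lemma innerRadius_ne_zero (hΩ : IsOpen Ω) (hne : Ω.Nonempty) : innerRadius Ω ≠ 0 := by
  intro h0
  obtain ⟨x, hx⟩ := hne
  obtain ⟨y, hy, hxy⟩ := exists_dist_le_innerRadius hΩ (by simp [h0]) x
  rw [h0, ENNReal.toReal_zero] at hxy
  exact hy (dist_le_zero.1 hxy ▸ hx)

/-- Sobolev and Poincaré inequalities interpolate to a weighted inequality. -/
lemma setLIntegral_weight_le {p s : ℝ} (hp : 1 < p) (hpN : p < N) (hs : N / p < s)
    {w φ : EuclideanSpace ℝ (Fin N) → ℝ} (hw : AEStronglyMeasurable w (volume.restrict Ω))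
    (hφ : Continuous φ) {ρ L E : ENNReal}
    (hSob : (∫⁻ x, ‖φ x‖ₑ ^ (N * p / (N - p))) ^ (1 - p / N) ≤ L * E)
    (hPoi : ∫⁻ x in Ω, ‖φ x‖ₑ ^ p ≤ L * ρ ^ p * E) :
    ∫⁻ x in Ω, ‖w x‖ₑ * ‖φ x‖ₑ ^ p ≤
      L * (ρ ^ ((s * p - N) / s) * eLpNorm w (ENNReal.ofReal s) (volume.restrict Ω)) * E := by
  have hp0 : 0 < p := by linarith
  have hN : (0 : ℝ) < N := by linarith
  have hNp : (0 : ℝ) < N - p := by linarith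
  have hs0 : 0 < s := lt_trans (by positivity) hs
  have hsp : N < s * p := by rwa [div_lt_iff₀ hp0] at hs
  have hθ : 0 ≤ 1 - N / (p * s) := by
    rw [sub_nonneg, div_le_one (by positivity)]; linarith
  have hpN' : 0 ≤ 1 - p / N := by rw [sub_nonneg, div_le_one hN]; exact hpN.le
  -- The three exponents sum to `1` and the powers of `|φ|` add up to `p`. The middle exponent is
  -- nonnegative because `s > N/p`.
  have h := ENNReal.lintegral_prod_norm_pow_le (μ := volume.restrict Ω) Finset.univ
    (f := ![fun x => ‖w x‖ₑ ^ s, fun x => ‖φ x‖ₑ ^ p, fun x => ‖φ x‖ₑ ^ (N * p / (N - p))])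
    (p := ![1 / s, 1 - N / (p * s), (1 - p / N) * (N / (p * s))])
    (by
      intro i _
      fin_cases i
      · exact hw.enorm.pow_const s
      · exact (hφ.enorm.measurable.pow_const _).aemeasurable
      · exact (hφ.enorm.measurable.pow_const _).aemeasurable)
    (by
      simp only [Fin.sum_univ_three, Matrix.cons_val]
      field_simp
      ring)
    (by
      intro i _
      fin_cases i
      · exact (by positivity : 0 ≤ 1 / s)
      · exact hθ
      · exact mul_nonneg hpN' (by positivity))
  simp only [Fin.prod_univ_three, Matrix.cons_val] at h
  have hpt : ∀ x, ‖w x‖ₑ * ‖φ x‖ₑ ^ p = (‖w x‖ₑ ^ s) ^ (1 / s) *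
      (‖φ x‖ₑ ^ p) ^ (1 - N / (p * s)) *
      (‖φ x‖ₑ ^ (N * p / (N - p))) ^ ((1 - p / N) * (N / (p * s))) := by
    intro x
    rw [← ENNReal.rpow_mul, mul_one_div_cancel hs0.ne', ENNReal.rpow_one, mul_assoc,
      ← ENNReal.rpow_mul, ← ENNReal.rpow_mul, ← ENNReal.rpow_add_of_nonneg _ _ (by positivity)
        (mul_nonneg (by positivity) (mul_nonneg hpN' (by positivity)))]
    congr 2
    field_simp
    ring
  simp_rw [hpt]
  refine h.trans ?_
  rw [eLpNorm_eq_lintegral_rpow_enorm_toReal (by simpa using hs0) ENNReal.ofReal_ne_top,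
    ENNReal.toReal_ofReal hs0.le, mul_assoc]
  calc _ ≤ (∫⁻ x in Ω, ‖w x‖ₑ ^ s) ^ (1 / s) *
        ((L * ρ ^ p * E) ^ (1 - N / (p * s)) * (L * E) ^ (N / (p * s))) := by
        gcongr
        rw [ENNReal.rpow_mul]
        gcongr
        exact (ENNReal.rpow_le_rpow (setLIntegral_le_lintegral _ _) hpN').trans hSob
    -- Using one constant `L` in both inequalities, its two powers recombine to `L` itself; hence
    -- the final constant does not depend on `s`.
    _ = (∫⁻ x in Ω, ‖w x‖ₑ ^ s) ^ (1 / s) * ((ρ ^ p) ^ (1 - N / (p * s)) *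
          ((L * E) ^ (1 - N / (p * s)) * (L * E) ^ (N / (p * s)))) := by
        rw [(by ring : L * ρ ^ p * E = ρ ^ p * (L * E)), ENNReal.mul_rpow_of_nonneg _ _ hθ]
        ring
    _ = _ := by
        rw [← ENNReal.rpow_add_of_nonneg _ _ hθ (by positivity), ← ENNReal.rpow_mul ρ,
          sub_add_cancel, ENNReal.rpow_one,
          (by field_simp : p * (1 - N / (p * s)) = (s * p - N) / s)]
        ring

/-- For `p < N`, an element of `W_0^{1,p}` with vanishing gradient vanishes. -/
lemma MemW01p.ae_eq_zero_of_lt {p : ℝ} (hp : 1 < p) (hpN : p < N) (hΩ : MeasurableSet Ω)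
    {u : EuclideanSpace ℝ (Fin N) → ℝ} {G : EuclideanSpace ℝ (Fin N) → EuclideanSpace ℝ (Fin N)}
    (h : MemW01p p Ω u G) (hG : ∫⁻ x in Ω, ‖G x‖ₑ ^ p = 0) : u =ᵐ[volume.restrict Ω] 0 := by
  have hp0 : 0 < p := by linarith
  obtain ⟨S, -, hS⟩ := exists_sobolev_const hp hpN
  -- `Ω` may have infinite measure, so Sobolev is applied on balls, with the indicator of a ball as
  -- weight.
  have hball : ∀ n : ℕ, ∀ᵐ x ∂(volume.restrict Ω), x ∈ Metric.ball 0 (n : ℝ) → u x = 0 := by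
    intro n
    set B : Set (EuclideanSpace ℝ (Fin N)) := Metric.ball 0 n with hB
    have hBm : MeasurableSet B := Metric.isOpen_ball.measurableSet
    have hW : Measurable (B.indicator fun _ => (1 : ENNReal)) := measurable_const.indicator hBm
    have h1 := h.lintegral_weight_le hp (W := B.indicator fun _ => 1) hW.aemeasurable
      (fun x => by by_cases hx : x ∈ B <;> simp [hx]) (A := volume B ^ (p / N) * S)
      (ENNReal.mul_ne_top (ENNReal.rpow_ne_top_of_nonneg (by positivity)
        measure_ball_lt_top.ne) ENNReal.coe_ne_top)
      (fun φ hφ => by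
        rw [hφ.lintegral_fderiv hp0 hΩ, mul_assoc]
        refine le_trans ?_ (setLIntegral_rpow_le_of_sobolev hp hpN hφ.1.continuous
          (hS φ (hφ.1.of_le (by simp)) hφ.2.1) B)
        rw [← lintegral_indicator hBm]
        refine (setLIntegral_le_lintegral _ _).trans (lintegral_mono fun x => ?_)
        by_cases hx : x ∈ B <;> simp [hx])
    have hm : AEMeasurable (fun x => B.indicator (fun _ => (1 : ENNReal)) x * ‖u x‖ₑ ^ p)
        (volume.restrict Ω) := hW.aemeasurable.mul (h.1.1.1.enorm.pow_const p)
    rw [hG, mul_zero, nonpos_iff_eq_zero, lintegral_eq_zero_iff' hm] at h1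
    filter_upwards [h1] with x hx hxB
    simpa [hxB, hp0, hp0.le, not_lt.2 hp0.le] using hx
  filter_upwards [ae_all_iff.2 hball] with x hx
  obtain ⟨n, hn⟩ := exists_nat_gt ‖x‖
  exact hx n (by simpa using hn)

/-- For `p > N`, an element of `W_0^{1,p}` with vanishing gradient vanishes. -/
lemma MemW01p.ae_eq_zero_of_gt {p : ℝ} (hN : 0 < N) (hp : 1 < p) (hpN : N < p)
    (hΩ : MeasurableSet Ω)
    {u : EuclideanSpace ℝ (Fin N) → ℝ} {G : EuclideanSpace ℝ (Fin N) → EuclideanSpace ℝ (Fin N)}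
    (h : MemW01p p Ω u G) (hG : ∫⁻ x in Ω, ‖G x‖ₑ ^ p = 0) : u =ᵐ[volume.restrict Ω] 0 := by
  have hp0 : 0 < p := by linarith
  obtain ⟨K, hK, hM⟩ := exists_morrey_const hp hpN
  obtain ⟨φ, hφ, hae, hu, hφG⟩ := h.exists_seq hp
  rw [hG] at hφG
  set U := ∫⁻ x in Ω, ‖u x‖ₑ ^ p with hU
  have hUt : U ≠ ⊤ := by
    rw [hU, ← eLpNorm_rpow_eq_lintegral _ _ hp0]
    exact ENNReal.rpow_ne_top_of_nonneg hp0.le h.1.1.2.ne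
  -- Morrey controls only differences, so the value at `x` is compared with the average over a ball.
  -- As `n → ∞` the gradient term drops out; then `r → ∞` forces `u x = 0`, since the volumes are
  -- unbounded while `u` is in `L^p`.
  have hest : ∀ (n : ℕ) (x : EuclideanSpace ℝ (Fin N)) (r : ℝ), 0 < r →
      ‖φ n x‖ₑ ^ p * volume (Metric.ball x r) ≤ 2 ^ (p - 1) * ((∫⁻ z in Ω, ‖φ n z‖ₑ ^ p) +
        K * ENNReal.ofReal r ^ (p - N) * volume (Metric.ball x r) *
          ∫⁻ z in Ω, ‖fderiv ℝ (φ n) z‖ₑ ^ p) := by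
    intro n x r hr
    rw [(hφ n).lintegral_fderiv hp0 hΩ]
    have hm : Measurable fun z => ‖φ n z‖ₑ ^ p :=
      (hφ n).1.continuous.enorm.measurable.pow_const p
    calc ‖φ n x‖ₑ ^ p * volume (Metric.ball x r) = ∫⁻ _ in Metric.ball x r, ‖φ n x‖ₑ ^ p := by simp
      _ ≤ ∫⁻ z in Metric.ball x r, 2 ^ (p - 1) * (‖φ n z‖ₑ ^ p +
          K * ENNReal.ofReal r ^ (p - N) * ∫⁻ z, ‖fderiv ℝ (φ n) z‖ₑ ^ p) := by
        refine setLIntegral_mono' Metric.isOpen_ball.measurableSet fun z hz => ?_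
        calc ‖φ n x‖ₑ ^ p = ‖φ n z + (φ n x - φ n z)‖ₑ ^ p := by rw [add_sub_cancel]
          _ ≤ (‖φ n z‖ₑ + ‖φ n x - φ n z‖ₑ) ^ p := by gcongr; exact enorm_add_le _ _
          _ ≤ 2 ^ (p - 1) * (‖φ n z‖ₑ ^ p + ‖φ n x - φ n z‖ₑ ^ p) :=
            ENNReal.rpow_add_le_mul_rpow_add_rpow _ _ hp.le
          _ ≤ _ := by
            gcongr
            refine hM _ ((hφ n).1.of_le (by simp)) x z r hr ?_
            rw [dist_comm]
            exact (Metric.mem_ball.1 hz).le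
      _ = 2 ^ (p - 1) * ((∫⁻ z in Metric.ball x r, ‖φ n z‖ₑ ^ p) +
        K * ENNReal.ofReal r ^ (p - N) * volume (Metric.ball x r) *
          ∫⁻ z, ‖fderiv ℝ (φ n) z‖ₑ ^ p) := by
        rw [lintegral_const_mul _ (by fun_prop), lintegral_add_left hm, lintegral_const,
          Measure.restrict_apply MeasurableSet.univ, Set.univ_inter]
        ring
      _ ≤ _ := by
        refine mul_le_mul' le_rfl (add_le_add ?_ le_rfl)
        rw [← lintegral_indicator hΩ]
        refine (setLIntegral_le_lintegral _ _).trans (lintegral_mono fun z => ?_)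
        by_cases hz : z ∈ Ω
        · simp [hz]
        · simp [hz, (hφ n).eq_zero hz, hp0]
  filter_upwards [hae] with x hx
  set Q : ENNReal := 2 ^ (p - 1) * U with hQ
  have hQt : Q ≠ ⊤ :=
    ENNReal.mul_ne_top (ENNReal.rpow_ne_top_of_nonneg (by linarith) (by simp)) hUt
  have hlim : ∀ r : ℝ, 0 < r → ‖u x‖ₑ ^ p * volume (Metric.ball x r) ≤ Q := by
    intro r hr
    have hc : K * ENNReal.ofReal r ^ (p - N) * volume (Metric.ball x r) ≠ ⊤ :=
      ENNReal.mul_ne_top (ENNReal.mul_ne_top hK (ENNReal.rpow_ne_top_of_nonneg (by linarith)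
        ENNReal.ofReal_ne_top)) measure_ball_lt_top.ne
    have hl : Filter.Tendsto (fun n => ‖φ n x‖ₑ ^ p * volume (Metric.ball x r)) Filter.atTop
        (nhds (‖u x‖ₑ ^ p * volume (Metric.ball x r))) :=
      ENNReal.Tendsto.mul_const ((ENNReal.continuous_rpow_const.tendsto _).comp
          ((continuous_enorm.tendsto _).comp hx)) (Or.inr measure_ball_lt_top.ne)
    have hr' := ENNReal.Tendsto.const_mul (a := (2 : ENNReal) ^ (p - 1))
      (hu.add (ENNReal.Tendsto.const_mul hφG (Or.inr hc)))
      (Or.inr (ENNReal.rpow_ne_top_of_nonneg (by linarith) (by simp)))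
    rw [mul_zero, add_zero] at hr'
    exact le_of_tendsto_of_tendsto' hl hr' fun n => hest n x r hr
  by_contra hux
  have hv : ‖u x‖ₑ ^ p ≠ 0 := by
    intro h0
    rcases ENNReal.rpow_eq_zero_iff.1 h0 with h0 | h0
    · exact hux (by simpa using h0.1)
    · linarith [h0.2]
  have : Nonempty (Fin N) := ⟨⟨0, hN⟩⟩
  have : NoncompactSpace (EuclideanSpace ℝ (Fin N)) := NormedSpace.noncompactSpace ℝ _
  have htop : ‖u x‖ₑ ^ p * ⊤ ≤ Q := by
    have hun : (⋃ n : ℕ, Metric.ball x ((n : ℝ) + 1)) = Set.univ := by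
      refine Set.eq_univ_of_forall fun y => Set.mem_iUnion.2 ?_
      obtain ⟨n, hn⟩ := exists_nat_gt (dist y x)
      exact ⟨n, Metric.mem_ball.2 (by linarith)⟩
    have hmono : Monotone fun n : ℕ => Metric.ball x ((n : ℝ) + 1) := fun a b hab =>
      Metric.ball_subset_ball (by have : (a : ℝ) ≤ b := by exact_mod_cast hab
                                  linarith)
    rw [← measure_univ_of_isAddLeftInvariant
      (volume : Measure (EuclideanSpace ℝ (Fin N))), ← hun, hmono.measure_iUnion, ENNReal.mul_iSup]
    exact iSup_le fun n => hlim _ (by positivity)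
  rw [ENNReal.mul_top hv] at htop
  exact hQt (top_le_iff.1 htop)

lemma ofReal_inv_div_le {L X l : ENNReal} (hL0 : L ≠ 0) (hLt : L ≠ ⊤) (h : (L * X)⁻¹ ≤ l) :
    ENNReal.ofReal (L.toReal)⁻¹ / X ≤ l := by
  rw [ENNReal.ofReal_inv_of_pos (ENNReal.toReal_pos hL0 hLt), ENNReal.ofReal_toReal hLt,
    div_eq_mul_inv, ← ENNReal.mul_inv (Or.inl hL0) (Or.inl hLt)]
  exact h

/-- Covers the convention `0 * ∞ = 0`: for a vanishing weight the constant is `0` even if the inner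
radius is infinite. -/
lemma setLIntegral_weight_eq_zero {p q : ℝ} (hq : 0 < q) {w φ : EuclideanSpace ℝ (Fin N) → ℝ}
    (hw : AEStronglyMeasurable w (volume.restrict Ω))
    (h : eLpNorm w (ENNReal.ofReal q) (volume.restrict Ω) = 0) :
    ∫⁻ x in Ω, ‖w x‖ₑ * ‖φ x‖ₑ ^ p = 0 := by
  rw [eLpNorm_eq_zero_iff hw (by simpa using hq)] at h
  refine (lintegral_congr_ae ?_).trans lintegral_zero
  filter_upwards [h] with x hx
  simp [hx]

/-- A Poincaré inequality with the inner radius implies the lower bound for the first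
eigenvalue. -/
lemma exists_const_le_firstEigenvalue {p : ℝ} (hp : 1 < p) (hpN : p < N) {K : ENNReal}
    (hK : K ≠ ⊤) :
    ∃ C : ℝ, 0 < C ∧ ∀ Ω : Set (EuclideanSpace ℝ (Fin N)), IsOpen Ω →
      (innerRadius Ω ≠ ⊤ → ∀ φ, IsTestFunction Ω φ →
        ∫⁻ x in Ω, ‖φ x‖ₑ ^ p ≤ K * innerRadius Ω ^ p * ∫⁻ x, ‖fderiv ℝ φ x‖ₑ ^ p) →
      ∀ s : ℝ, N / p < s → ∀ w : EuclideanSpace ℝ (Fin N) → ℝ,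
        MemLp w (ENNReal.ofReal s) (volume.restrict Ω) →
        ENNReal.ofReal C / (innerRadius Ω ^ ((s * p - N) / s) *
          eLpNorm w (ENNReal.ofReal s) (volume.restrict Ω)) ≤ firstEigenvalue p Ω w := by
  have hp0 : 0 < p := by linarith
  obtain ⟨S, hS0, hS⟩ := exists_sobolev_const hp hpN
  have hL0 : K + S ≠ 0 := fun h => hS0.ne' (by exact_mod_cast (add_eq_zero.1 h).2)
  have hLt : K + S ≠ ⊤ := ENNReal.add_ne_top.2 ⟨hK, ENNReal.coe_ne_top⟩
  refine ⟨((K + S).toReal)⁻¹, inv_pos.2 (ENNReal.toReal_pos hL0 hLt),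
    fun Ω hΩ hPoi s hs w hw => ?_⟩
  have hN : (0 : ℝ) < N := by linarith
  have hs0 : 0 < s := lt_trans (by positivity) hs
  have hsp : N < s * p := by rwa [div_lt_iff₀ hp0] at hs
  refine ofReal_inv_div_le hL0 hLt (inv_le_firstEigenvalue hp hw.1 (fun hA φ hφ => ?_)
    fun u G huG hG => huG.ae_eq_zero_of_lt hp hpN hΩ.measurableSet hG)
  rw [hφ.lintegral_fderiv hp0 hΩ.measurableSet]
  rcases eq_or_ne (eLpNorm w (ENNReal.ofReal s) (volume.restrict Ω)) 0 with h0 | h0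
  · rw [setLIntegral_weight_eq_zero hs0 hw.1 h0]
    exact zero_le
  -- With a nonzero weight, an infinite inner radius would make the constant `⊤`, where the bound is
  -- trivial and nothing has to be proved.
  have hr : innerRadius Ω ≠ ⊤ := by
    intro hr
    rw [hr, ENNReal.top_rpow_of_pos (div_pos (by linarith) hs0), ENNReal.top_mul h0,
      ENNReal.mul_top hL0] at hA
    exact hA rfl
  refine setLIntegral_weight_le hp hpN hs hw.1 hφ.1.continuous ?_ ?_
  · refine (hS φ (hφ.1.of_le (by simp)) hφ.2.1).trans ?_
    gcongr
    exact le_add_self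
  · refine (hPoi hr φ hφ).trans ?_
    gcongr
    exact le_self_add

end FirstEigenvalue

/-! ### Assembly of the three bounds. -/

theorem corollary2p6 (N : ℕ) (hN : 0 < N) (p : ℝ) (hp : 1 < p) :
    ((N : ℝ) < p →
      ∃ C : ℝ, 0 < C ∧
        ∀ Ω : Set (EuclideanSpace ℝ (Fin N)), IsOpen Ω →
        ∀ w : EuclideanSpace ℝ (Fin N) → ℝ,
          MemLp w 1 (volume.restrict Ω) → (∀ᵐ x ∂(volume.restrict Ω), 0 ≤ w x) →
          ENNReal.ofReal C /
              (innerRadius Ω ^ (p - N) * eLpNorm w 1 (volume.restrict Ω))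
            ≤ firstEigenvalue p Ω w) ∧
    (p < (N : ℝ) →
      (∀ c : ℝ, 0 < c → ∃ C : ℝ, 0 < C ∧
        ∀ Ω : Set (EuclideanSpace ℝ (Fin N)), IsOpen Ω → IsUniformlyFat p c Ωᶜ →
        ∀ s : ℝ, N / p < s →
        ∀ w : EuclideanSpace ℝ (Fin N) → ℝ,
          MemLp w (ENNReal.ofReal s) (volume.restrict Ω) →
          ENNReal.ofReal C /
              (innerRadius Ω ^ ((s * p - N) / s) *
                eLpNorm w (ENNReal.ofReal s) (volume.restrict Ω))
            ≤ firstEigenvalue p Ω w) ∧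
      (∀ Ω : Set (EuclideanSpace ℝ (Fin N)), IsOpen Ω → volume Ω < ⊤ →
        ∃ C : ℝ, 0 < C ∧
        ∀ s : ℝ, N / p < s →
        ∀ w : EuclideanSpace ℝ (Fin N) → ℝ,
          MemLp w (ENNReal.ofReal s) (volume.restrict Ω) →
          ENNReal.ofReal C /
              (innerRadius Ω ^ ((s * p - N) / s) *
                eLpNorm w (ENNReal.ofReal s) (volume.restrict Ω))
            ≤ firstEigenvalue p Ω w)) := by
  have hp0 : 0 < p := by linarith
  refine ⟨fun hpN => ?_, fun hpN => ⟨fun c hc => ?_, fun Ω hΩ hfin => ?_⟩⟩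
  · obtain ⟨K, hK, hM⟩ := exists_morrey_const hp hpN
    have hL0 : K + 1 ≠ 0 := by simp
    have hLt : K + 1 ≠ ⊤ := ENNReal.add_ne_top.2 ⟨hK, ENNReal.one_ne_top⟩
    refine ⟨((K + 1).toReal)⁻¹, inv_pos.2 (ENNReal.toReal_pos hL0 hLt), fun Ω hΩ w hw _ => ?_⟩
    refine ofReal_inv_div_le hL0 hLt (inv_le_firstEigenvalue hp hw.1 (fun hA φ hφ => ?_)
      fun u G huG hG => huG.ae_eq_zero_of_gt hN hp hpN hΩ.measurableSet hG)
    rw [hφ.lintegral_fderiv hp0 hΩ.measurableSet]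
    -- The empty set has inner radius `0`, while Morrey's inequality is applied at a positive
    -- radius.
    rcases Ω.eq_empty_or_nonempty with rfl | hne
    · simp
    rcases eq_or_ne (eLpNorm w 1 (volume.restrict Ω)) 0 with h0 | h0
    · rw [setLIntegral_weight_eq_zero one_pos hw.1 (by simpa using h0)]
      exact zero_le
    have hr : innerRadius Ω ≠ ⊤ := by
      intro hr
      rw [hr, ENNReal.top_rpow_of_pos (by linarith), ENNReal.top_mul h0,
        ENNReal.mul_top hL0] at hA
      exact hA rfl
    have hr0 := ENNReal.toReal_pos (innerRadius_ne_zero hΩ hne) hr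
    have hpt : ∀ x, ‖w x‖ₑ * ‖φ x‖ₑ ^ p ≤ ‖w x‖ₑ * ((K + 1) * innerRadius Ω ^ (p - N) *
        ∫⁻ x, ‖fderiv ℝ φ x‖ₑ ^ p) := by
      intro x
      obtain ⟨y, hy, hxy⟩ := exists_dist_le_innerRadius hΩ hr x
      have h := hM φ (hφ.1.of_le (by simp)) x y _ hr0 hxy
      rw [hφ.eq_zero hy, sub_zero, ENNReal.ofReal_toReal hr] at h
      gcongr
      refine h.trans ?_
      gcongr
      exact le_self_add
    refine (lintegral_mono hpt).trans (le_of_eq ?_)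
    rw [lintegral_mul_const'' _ hw.1.enorm, eLpNorm_one_eq_lintegral_enorm]
    ring
  · obtain ⟨K, hK, hP⟩ := exists_poincare_const_of_fat hp hpN hc
    obtain ⟨C, hC, h⟩ := exists_const_le_firstEigenvalue hp hpN hK
    refine ⟨C, hC, fun Ω hΩ hfat => h Ω hΩ fun hr φ hφ => ?_⟩
    rcases Ω.eq_empty_or_nonempty with rfl | hne
    · simp
    have hr0 := ENNReal.toReal_pos (innerRadius_ne_zero hΩ hne) hr
    have h := hP φ Ωᶜ hφ.1 (fun x hx => hφ.eq_zero hx) hfat _ hr0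
      fun x => exists_dist_le_innerRadius hΩ hr x
    rw [ENNReal.ofReal_toReal hr] at h
    exact (setLIntegral_le_lintegral _ _).trans h
  · have hN0 : (0 : ℝ) < N := by exact_mod_cast hN
    rcases Ω.eq_empty_or_nonempty with rfl | hne
    · obtain ⟨C, hC, h⟩ := exists_const_le_firstEigenvalue hp hpN ENNReal.zero_ne_top
      exact ⟨C, hC, h ∅ hΩ fun _ φ _ => by simp⟩
    obtain ⟨S, hS0, hS⟩ := exists_sobolev_const hp hpN
    have hr0 := innerRadius_ne_zero hΩ hne
    have hrp : innerRadius Ω ^ p ≠ 0 := fun h0 => by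
      rcases ENNReal.rpow_eq_zero_iff.1 h0 with h0 | h0
      · exact hr0 h0.1
      · linarith [h0.2]
    have hV : volume Ω ^ (p / N) * S ≠ ⊤ := ENNReal.mul_ne_top
      (ENNReal.rpow_ne_top_of_nonneg (by positivity) hfin.ne) ENNReal.coe_ne_top
    -- Dividing by `r_Ω^p` puts the Sobolev constant of a set of finite measure into the form `K *
    -- r_Ω^p`; this is where the constant comes to depend on `Ω`.
    obtain ⟨C, hC, h⟩ := exists_const_le_firstEigenvalue hp hpN
      (K := volume Ω ^ (p / N) * S * (innerRadius Ω ^ p)⁻¹)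
      (ENNReal.mul_ne_top hV (ENNReal.inv_ne_top.2 hrp))
    refine ⟨C, hC, h Ω hΩ fun hr φ hφ => ?_⟩
    rw [mul_assoc _ (innerRadius Ω ^ p)⁻¹, ENNReal.inv_mul_cancel hrp
      (ENNReal.rpow_ne_top_of_nonneg hp0.le hr), mul_one, mul_assoc]
    exact setLIntegral_rpow_le_of_sobolev hp hpN hφ.1.continuous
      (hS φ (hφ.1.of_le (by simp)) hφ.2.1) Ω
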